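/- Let $D$ be a diagram of an $l$-component link on the 2-sphere: a union of $l$ closed curves whose only singularities are transverse double points (the $n$ crossings), each with over/under information. Assume $n\ge 1$ and that the projection image has $d$ connected components. The regions of $D$ are the connected components of the complement of the projection image. Define two integer matrices whose rows are indexed by the crossings $x_i$ and whose columns are indexed by the regions $R_j$. The definite region choice matrix of the single counting rule, $A_{d1}(D)$, has entry $1$ if $x_i\in\partial R_j$ and $0$ otherwise. The alternating region choice matrix of the single counting rule, $A_{a1}(D)$, has entry $1$ if $R_j$ touches $x_i$ at a corner which, counterclockwise about $x_i$, is bounded first by the underpass and then by the overpass; entry $-1$ if $R_j$ touches $x_i$ at a corner which, counterclockwise about $x_i$, is bounded first by the overpass and then by the underpass; and entry $0$ if $x_i\notin\partial R_j$. (A region that touches a crossing at two corners touches it at two opposite ones, so these entries are well defined.) Then $D$ has $n+d+1$ regions, both matrices have rank $$\operatorname{rank} A_{d1}(D)=\operatorname{rank} A_{a1}(D)=n+d-l,$$ and both $\mathbb{Z}$-submodules $$\{\mathbf u\in\mathbb{Z}^{n+d+1}\mid A_{d1}(D)\mathbf u=\mathbf 0\},\qquad \{\mathbf u\in\mathbb{Z}^{n+d+1}\mid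 A_{a1}(D)\mathbf u=\mathbf 0\}$$ have rank $l+1$. -/

import Mathlib

/-!
# Link diagrams on the 2-sphere and their region choice matrices

A link diagram is presented as a subcomplex of a finite cell structure of the 2-sphere.  The cell
structure is given by its oriented edges ("darts"), the permutation which turns a dart
counterclockwise about its initial vertex and the involution which reverses a dart; it is a cell
structure of the sphere when it is connected and has Euler characteristic 2.  The projection image
is a union of edges in which every vertex has degree 0, 2 or 4; the vertices of degree 4 are the
crossings, and they carry over/under information.  The cell structure may contain edges which do
not belong to the diagram.  So the diagram may be disconnected, its components may be
nested in each other, and some of them may be closed curves without crossings.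
-/

/-- A finite cell structure of the oriented 2-sphere, with set of darts `E`. -/
structure CellularSphere (E : Type*) where
  /-- the next dart, counterclockwise, with the same initial vertex -/
  rot : Equiv.Perm E
  /-- the same edge, with the opposite direction -/
  rev : Equiv.Perm E
  rev_rev : ∀ a, rev (rev a) = a
  rev_ne : ∀ a, rev a ≠ a
  /-- the underlying surface is connected -/
  connected : ∀ a b, Relation.EqvGen (fun x y => y = rot x ∨ y = rev x) a b
  /-- (number of vertices) + (number of faces) = (number of edges) + 2.  The face to the left of a
  dart `a` has `rot⁻¹ (rev a)` as the next dart on its boundary. -/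
  euler : Nat.card (Quotient (Equiv.Perm.SameCycle.setoid rot))
      + Nat.card (Quotient (Equiv.Perm.SameCycle.setoid (rot⁻¹ * rev)))
    = Nat.card (Quotient (Equiv.Perm.SameCycle.setoid rev)) + 2

namespace CellularSphere

variable {E : Type*} (S : CellularSphere E)

/-- The vertices: the cycles of the counterclockwise rotation. -/
abbrev Vertex : Type _ := Quotient (Equiv.Perm.SameCycle.setoid S.rot)

/-- The faces (2-cells): the cycles of the boundary permutation `rot⁻¹ * rev`. -/
abbrev Face : Type _ := Quotient (Equiv.Perm.SameCycle.setoid (S.rot⁻¹ * S.rev))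

/-- The initial vertex of a dart. -/
def vertex (a : E) : S.Vertex := Quotient.mk _ a

/-- The face to the left of a dart.  At the initial vertex of `a` it contains the corner
between `a` and `rot a`. -/
def face (a : E) : S.Face := Quotient.mk _ a

/-- The number of darts of the set `A` which start at the vertex `v`. -/
noncomputable def degree (A : Set E) (v : S.Vertex) : ℕ := Nat.card {a : E // a ∈ A ∧ S.vertex a = v}

/-- The first dart of `A` after `a` in counterclockwise order about the initial vertex of `a`. -/
noncomputable def turn (A : Set E) (a : E) : E := (S.rot ^ sInf {k : ℕ | 0 < k ∧ (S.rot ^ k) a ∈ A}) a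

end CellularSphere

/-- A link diagram on the 2-sphere. -/
structure LinkDiagram (E : Type*) extends CellularSphere E where
  /-- the darts of the edges which make up the projection image -/
  darts : Set E
  rev_mem : ∀ a ∈ darts, rev a ∈ darts
  degree_eq : ∀ v, toCellularSphere.degree darts v = 0 ∨ toCellularSphere.degree darts v = 2 ∨
    toCellularSphere.degree darts v = 4
  /-- the darts which belong to the overpass of the crossing at which they start (the membership
  of other darts has no meaning) -/
  overpass : Set E
  /-- about a crossing, darts of the overpass and of the underpass alternate -/
  overpass_turn : ∀ a ∈ darts, toCellularSphere.degree darts (toCellularSphere.vertex a) = 4 →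
    (toCellularSphere.turn darts a ∈ overpass ↔ a ∉ overpass)

namespace LinkDiagram

variable {E : Type*} (D : LinkDiagram E)

/-- The crossings: the double points of the projection image. -/
def Crossing : Type _ := {v : D.Vertex // D.degree D.darts v = 4}

/-- The regions: the connected components of the complement of the projection image.  Two faces lie
in the same region if one can pass from one to the other through edges not in the diagram. -/
def Region : Type _ := Quot (fun f g : D.Face => ∃ a, a ∉ D.darts ∧ f = D.face a ∧ g = D.face (D.rev a))

/-- The region to the left of a dart. -/
def region (a : E) : D.Region := Quot.mk _ (D.face a)

/-- The connected components of the projection image. -/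
def ConnComp : Type _ := Quot (fun a b : D.darts => b.1 = D.rev a.1 ∨ D.vertex b.1 = D.vertex a.1)

open Classical in
/-- The dart of the diagram at the same vertex as the dart `a` of the diagram which continues the
strand of `a` through that vertex: the opposite one of four, or the other one of two. -/
noncomputable def straight (a : E) : E :=
  if D.degree D.darts (D.vertex a) = 4 then D.turn D.darts (D.turn D.darts a) else D.turn D.darts a

/-- The components of the link: the closed curves traced by going straight at every crossing. -/
def LinkComp : Type _ := Quot (fun a b : D.darts => b.1 = D.rev a.1 ∨ b.1 = D.straight a.1)

/-- The crossing `x` lies on the boundary of the region `R`. -/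
def OnBoundary (x : D.Crossing) (R : D.Region) : Prop := ∃ a, D.vertex a = x.1 ∧ D.region a = R

/-- `R` touches `x` at a corner bounded by the underpass and then, counterclockwise,
the overpass. -/
def TouchesPos (x : D.Crossing) (R : D.Region) : Prop :=
  ∃ a ∈ D.darts, D.vertex a = x.1 ∧ a ∉ D.overpass ∧ D.region a = R

/-- `R` touches `x` at a corner bounded by the overpass and then, counterclockwise,
the underpass. -/
def TouchesNeg (x : D.Crossing) (R : D.Region) : Prop :=
  ∃ a ∈ D.darts, D.vertex a = x.1 ∧ a ∈ D.overpass ∧ D.region a = R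

open Classical in
/-- The definite region choice matrix of the single counting rule. -/
noncomputable def definiteSingle : Matrix D.Crossing D.Region ℤ :=
  Matrix.of fun x R => if D.OnBoundary x R then 1 else 0

open Classical in
/-- The alternating region choice matrix of the single counting rule.  (A region never touches
a crossing at two adjacent corners, so the first two cases exclude each other.) -/
noncomputable def alternatingSingle : Matrix D.Crossing D.Region ℤ :=
  Matrix.of fun x R => if D.TouchesPos x R then 1 else if D.TouchesNeg x R then -1 else 0

instance [Finite E] : Finite D.Region := inferInstanceAs (Finite (Quot _))

noncomputable instance [Finite E] : Fintype D.Region := Fintype.ofFinite _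

end LinkDiagram

/-! ### Cycle spaces of finite graphs -/

section CycleSpace

/-! Give each region an unknown `u R` and record the jumps of `u` across the edges of the diagram.
On the sphere a function on the darts is such a jump function exactly when it is a cycle of the
projection graph, that is, antisymmetric with zero sum at every vertex (`range_jump`,
`range_regionJump`); the kernel consists of the constants. The dimension of the cycle space then
gives the number of regions. Over `ZMod 2` the constant 1 is a cycle, since all degrees are even,
and its potential is a checkerboard colouring. After multiplying columns by the colouring signs, the
definite equation at a crossing with corner regions R0, R1, R2, R3 becomes u R0 - u R1 + u R2 - u R3
= 0, except that a region occupying two opposite corners is counted once. The alternating matrix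
differs from the definite one only by signs of rows and columns, so both kernels have the same rank.
If such a region were counted twice, the equation would say that the jump is constant along each
strand through the crossing. The admissible jumps then form a space of dimension l, one value per
link component, and the kernel has dimension l + 1. To pass from double to single counting, give
each crossing a weight t, so that a doubled region counts 2 - t times, and change one weight at a
time (`cornerKer_change_weight`). Only a crossing with R0 = R2 (up to a quarter turn) matters. A
closed curve inside R0 through this crossing separates R1 from R3 (`exists_separation`). Cutting off
a solution with u R0 = 0 and u R1 = 1 along that curve gives w, which violates only the equation at
this crossing. Subtracting a multiple of w, proportional to u R0, carries one kernel isomorphically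
onto the other. Clearing denominators identifies the integral and rational ranks, and rank-nullity
gives the ranks of the matrices. -/

open Classical in
/-- The antisymmetric functions on the darts of a graph whose sum about every vertex vanishes. -/
noncomputable def cycleSpace (k : Type*) [Field k] {X V : Type*} [Fintype X] (rev : X → X)
    (p : X → V) : Submodule k (X → k) where
  carrier := {h | (∀ a, h (rev a) = -h a) ∧ ∀ v, ∑ a with p a = v, h a = 0}
  add_mem' := by
    rintro f g ⟨hf, hf'⟩ ⟨hg, hg'⟩
    refine ⟨fun a => ?_, fun v => ?_⟩
    · simp only [Pi.add_apply, hf, hg]; ring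
    · simp only [Pi.add_apply, Finset.sum_add_distrib, hf', hg', add_zero]
  zero_mem' := by simp
  smul_mem' := by
    rintro c f ⟨hf, hf'⟩
    refine ⟨fun a => ?_, fun v => ?_⟩
    · simp only [Pi.smul_apply, hf, smul_neg]
    · simp only [Pi.smul_apply, ← Finset.smul_sum, hf', smul_zero]

/-- Two elements lie in the same orbit of an involution iff they are equal or exchanged. -/
theorem quot_involution_eq_iff {X : Type*} (s : X → X) (hs : ∀ a, s (s a) = a) (a b : X) :
    Quot.mk (fun a b => b = s a) a = Quot.mk _ b ↔ a = b ∨ b = s a := by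
  rw [Quot.eq]
  constructor
  · intro h
    induction h with
    | rel _ _ h => exact Or.inr h
    | refl => exact Or.inl rfl
    | symm _ _ _ ih =>
      rcases ih with rfl | rfl
      · exact Or.inl rfl
      · exact Or.inr (hs _).symm
    | trans _ _ _ _ _ ih1 ih2 =>
      rcases ih1 with rfl | rfl
      · exact ih2
      · rcases ih2 with rfl | rfl
        · exact Or.inr rfl
        · exact Or.inl (hs _).symm
  · rintro (rfl | h)
    · exact .refl _
    · exact .rel _ _ h

/-- The orbits of an involution without fixed points have two elements. -/
theorem two_mul_card_quot_involution {X : Type*} [Finite X] (s : X → X) (hs : ∀ a, s (s a) = a)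
    (hne : ∀ a, s a ≠ a) : 2 * Nat.card (Quot fun a b => b = s a) = Nat.card X := by
  classical
  have := Fintype.ofFinite X
  have key := quot_involution_eq_iff s hs
  have : Fintype (Quot fun a b => b = s a) := Fintype.ofFinite _
  rw [Nat.card_eq_fintype_card, Nat.card_eq_fintype_card, ← Finset.card_univ (α := X),
    Finset.card_eq_sum_card_fiberwise (f := Quot.mk (fun a b => b = s a)) (t := Finset.univ)
      (by simp [Set.MapsTo])]
  rw [Finset.sum_const_nat (m := 2), Finset.card_univ, mul_comm]
  intro q _
  induction q using Quot.ind with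
  | mk a =>
    have : ({b : X | Quot.mk (fun a b => b = s a) b = Quot.mk _ a} : Finset X) = {a, s a} := by
      ext b
      simp only [Finset.mem_filter, Finset.mem_univ, true_and, Finset.mem_insert,
        Finset.mem_singleton, key]
      constructor
      · rintro (h | rfl)
        · exact Or.inl h
        · exact Or.inr (hs _).symm
      · rintro (h | rfl)
        · exact Or.inl h
        · exact Or.inr (hs _).symm
    rw [this, Finset.card_pair (hne a).symm]

/-- An involution without fixed points has a choice of signs. -/
theorem exists_orientation (k : Type*) [Field k] {X : Type*} (s : X → X) (hs : ∀ a, s (s a) = a)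
    (hne : ∀ a, s a ≠ a) : ∃ o : X → k, (∀ a, o (s a) = -o a) ∧ ∀ a, o a * o a = 1 := by
  classical
  refine ⟨fun a => if (Quot.mk (fun a b => b = s a) a).out = a then 1 else -1, fun a => ?_,
    fun a => by dsimp only; split_ifs <;> simp⟩
  have h1 : Quot.mk (fun a b => b = s a) (s a) = Quot.mk _ a :=
    (Quot.sound (r := fun a b => b = s a) rfl).symm
  dsimp only
  rw [h1]
  rcases (quot_involution_eq_iff s hs _ _).1 (Quot.out_eq (Quot.mk (fun a b => b = s a) a)) with h | h
  · rw [if_neg (by rw [h]; exact (hne a).symm), if_pos h]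
  · rw [if_pos (by nth_rw 2 [h]; rw [hs]),
      if_neg (by intro h'; rw [h'] at h; exact hne a h.symm), neg_neg]

open Classical in
theorem sum_quot_mul {k : Type*} [Field k] {X : Type*} [Fintype X] (r : X → X → Prop)
    [Fintype (Quot r)] (m : X → k) (h : Quot r → k) :
    ∑ e, (∑ a with Quot.mk r a = e, m a) * h e = ∑ a, m a * h (Quot.mk r a) := by
  rw [← Finset.sum_fiberwise (s := Finset.univ) (g := Quot.mk r)
    (f := fun a => m a * h (Quot.mk r a))]
  refine Finset.sum_congr rfl fun e _ => ?_
  rw [Finset.sum_mul]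
  refine Finset.sum_congr rfl fun a ha => ?_
  rw [(Finset.mem_filter.1 ha).2]

/-- The dimension of the cycle space of a graph. -/
theorem finrank_cycleSpace (k : Type*) [Field k] {X V : Type*} [Fintype X] [Finite V] (rev : X → X)
    (p : X → V) (hrev : ∀ a, rev (rev a) = a) (hne : ∀ a, rev a ≠ a) (hp : Function.Surjective p) :
    Module.finrank k (cycleSpace k rev p) + Nat.card V =
      Nat.card (Quot fun a b => b = rev a) + Nat.card (Quot fun a b => b = rev a ∨ p b = p a) := by
  classical
  have := Fintype.ofFinite V
  obtain ⟨o, ho, ho1⟩ := exists_orientation k rev hrev hne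
  let r : X → X → Prop := fun a b => b = rev a
  let q : X → X → Prop := fun a b => b = rev a ∨ p b = p a
  have : Fintype (Quot r) := Fintype.ofFinite _
  have : Fintype (Quot q) := Fintype.ofFinite _
  -- The signed incidence matrix. Its kernel is the cycle space, read through the orientation `o`;
  -- the kernel of its transpose consists of the functions constant on components. The formula
  -- follows from equality of row and column rank.
  let M : Matrix V (Quot r) k := Matrix.of fun v e =>
    ∑ a with Quot.mk r a = e, if p a = v then o a else 0
  have hM : ∀ h v, M.mulVec h v = ∑ a with p a = v, o a * h (Quot.mk r a) := by
    intro h v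
    simp only [M, Matrix.mulVec, dotProduct, Matrix.of_apply]
    rw [sum_quot_mul, Finset.sum_filter]
    simp only [ite_mul, zero_mul]
  have hsq : ∀ a, Quot.mk r (rev a) = Quot.mk r a := fun a =>
    (Quot.sound (r := r) rfl).symm
  have hfib : ∀ a, ({b : X | Quot.mk r b = Quot.mk r a} : Finset X) = {a, rev a} := by
    intro a
    ext b
    simp only [Finset.mem_filter, Finset.mem_univ, true_and, Finset.mem_insert,
        Finset.mem_singleton]
    constructor
    · intro h
      rcases (quot_involution_eq_iff rev hrev b a).1 h with h | h
      · exact Or.inl h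
      · exact Or.inr (by rw [h, hrev])
    · rintro (rfl | rfl)
      · rfl
      · exact hsq a
  have hMT : ∀ g a, M.transpose.mulVec g (Quot.mk r a) = o a * (g (p a) - g (p (rev a))) := by
    intro g a
    simp only [M, Matrix.mulVec, dotProduct, Matrix.of_apply, Matrix.transpose_apply, hfib]
    simp only [Finset.sum_pair (hne a).symm, add_mul, ite_mul, zero_mul, Finset.sum_add_distrib,
      Finset.sum_ite_eq, Finset.mem_univ, if_true, ho]
    ring
  have e1 : LinearMap.ker M.mulVecLin ≃ₗ[k] cycleSpace k rev p :=
    { toFun := fun h => ⟨fun a => o a * h.1 (Quot.mk r a), by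
        refine ⟨fun a => ?_, fun v => ?_⟩
        · dsimp only
          rw [ho, hsq]; ring
        · rw [← hM]
          exact congrFun h.2 v⟩
      map_add' := by
        intro x y
        ext a
        simp [mul_add]
      map_smul' := by
        intro x y
        ext a
        simp; ring
      invFun := fun h => ⟨Quot.lift (fun a => o a * h.1 a) (by
          rintro a _ rfl
          rw [ho, h.2.1]; ring), by
          rw [LinearMap.mem_ker]
          ext v
          rw [Matrix.mulVecLin_apply, hM]
          refine Eq.trans ?_ (h.2.2 v)
          refine Finset.sum_congr rfl fun a _ => ?_
          dsimp only
          rw [← mul_assoc, ho1, one_mul]⟩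
      left_inv := by
        intro h
        ext e
        induction e using Quot.ind with
        | mk a =>
          dsimp only
          rw [← mul_assoc, ho1, one_mul]
      right_inv := by
        intro h
        ext a
        dsimp only
        rw [← mul_assoc, ho1, one_mul] }
  have hone : ∀ a (x : k), o a * x = 0 → x = 0 := by
    intro a x hx
    have : o a * (o a * x) = 0 := by rw [hx, mul_zero]
    rwa [← mul_assoc, ho1, one_mul] at this
  have hker : ∀ g, g ∈ LinearMap.ker M.transpose.mulVecLin ↔ ∀ a, g (p a) = g (p (rev a)) := by
    intro g
    rw [LinearMap.mem_ker]
    constructor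
    · intro h a
      have := congrFun h (Quot.mk r a)
      rw [Matrix.mulVecLin_apply, hMT] at this
      exact sub_eq_zero.1 (hone a _ this)
    · intro h
      ext e
      induction e using Quot.ind with
      | mk a => rw [Matrix.mulVecLin_apply, hMT, h a]; simp
  have hinv : ∀ v, p (Function.surjInv hp v) = v := Function.surjInv_eq hp
  have e2 : LinearMap.ker M.transpose.mulVecLin ≃ₗ[k] (Quot q → k) :=
    { toFun := fun g => Quot.lift (fun a => g.1 (p a)) (by
        rintro a b (rfl | h)
        · exact (hker _).1 g.2 a
        · exact congrArg g.1 h.symm)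
      map_add' := by
        intro x y
        ext a
        induction a using Quot.ind with | mk a => rfl
      map_smul' := by
        intro x y
        ext a
        induction a using Quot.ind with | mk a => rfl
      invFun := fun g => ⟨fun v => g (Quot.mk q (Function.surjInv hp v)), by
        rw [hker]
        intro a
        congr 1
        have h1 : ∀ a, Quot.mk q (Function.surjInv hp (p a)) = Quot.mk q a := fun a =>
          Quot.sound (Or.inr (hinv _).symm)
        rw [h1, h1]
        exact Quot.sound (Or.inl rfl)⟩
      left_inv := by
        intro g
        ext v
        exact congrArg g.1 (hinv v)
      right_inv := by
        intro g
        ext a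
        induction a using Quot.ind with
        | mk a =>
          dsimp only
          congr 1
          exact Quot.sound (Or.inr (hinv _).symm) }
  have r1 := LinearMap.finrank_range_add_finrank_ker M.mulVecLin
  have r2 := LinearMap.finrank_range_add_finrank_ker M.transpose.mulVecLin
  have r3 : M.transpose.rank = M.rank := Matrix.rank_transpose M
  rw [Matrix.rank, Matrix.rank] at r3
  rw [e1.finrank_eq, Module.finrank_fintype_fun_eq_card] at r1
  rw [e2.finrank_eq, Module.finrank_fintype_fun_eq_card, Module.finrank_fintype_fun_eq_card] at r2
  change _ = Nat.card (Quot r) + Nat.card (Quot q)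
  rw [Nat.card_eq_fintype_card, Nat.card_eq_fintype_card, Nat.card_eq_fintype_card]
  omega

open Classical in
/-- A functional which vanishes on the cycle space is a coboundary. -/
theorem exists_coboundary_of_vanish (k : Type*) [Field k] {X V : Type*} [Fintype X] [Finite V]
    (rev : X → X) (p : X → V) (hrev : ∀ a, rev (rev a) = a)
    (c : X → k) (hc : ∀ h ∈ cycleSpace k rev p, ∑ a, c a * h a = 0) :
    ∃ g : V → k, ∀ a, c a - c (rev a) = g (p a) - g (p (rev a)) := by
  have := Fintype.ofFinite V
  let W : Submodule k (X → k) :=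
    { carrier := {h | ∀ a, h (rev a) = -h a}
      add_mem' := by
        intro f g hf hg a
        simp only [Pi.add_apply, hf a, hg a]; ring
      zero_mem' := by simp
      smul_mem' := by
        intro c f hf a
        simp only [Pi.smul_apply, hf a, smul_neg] }
  let div : W →ₗ[k] (V → k) :=
    { toFun := fun h v => ∑ a with p a = v, h.1 a
      map_add' := by intro x y; ext v; simp [Finset.sum_add_distrib]
      map_smul' := by intro x y; ext v; simp [Finset.mul_sum] }
  let ψ : W →ₗ[k] k :=
    { toFun := fun h => ∑ a, c a * h.1 a
      map_add' := by intro x y; simp [mul_add, Finset.sum_add_distrib]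
      map_smul' := by
        intro x y
        simp only [Submodule.coe_smul, Pi.smul_apply, smul_eq_mul, Finset.mul_sum,
          RingHom.id_apply]
        exact Finset.sum_congr rfl fun _ _ => by ring }
  have h1 : ψ ∈ (LinearMap.ker div).dualAnnihilator := by
    rw [Submodule.mem_dualAnnihilator]
    intro h hh
    exact hc h.1 ⟨h.2, fun v => congrFun hh v⟩
  -- A functional that kills the kernel of the divergence factors through the divergence. The factor
  -- `G`, evaluated at point masses, is the potential `g`; the test function below is the unit flow
  -- along the edge of `a`.
  rw [← LinearMap.range_dualMap_eq_dualAnnihilator_ker] at h1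
  obtain ⟨G, hG⟩ := h1
  refine ⟨fun v => G (Pi.single v 1), fun a => ?_⟩
  let h : W := ⟨Pi.single a 1 - Pi.single (rev a) 1, by
    intro b
    have i1 : (rev b = a) ↔ (b = rev a) := ⟨fun h => by rw [← h, hrev], fun h => by rw [h, hrev]⟩
    have i2 : (rev b = rev a) ↔ (b = a) := ⟨fun h => by rw [← hrev b, h, hrev], fun h => by rw [h]⟩
    simp only [Pi.sub_apply, Pi.single_apply, i1, i2]
    ring⟩
  have h2 := LinearMap.congr_fun hG h
  have h3 : div h = Pi.single (p a) 1 - Pi.single (p (rev a)) 1 := by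
    ext v
    simp only [div, h, LinearMap.coe_mk, AddHom.coe_mk, Pi.sub_apply]
    rw [Finset.sum_sub_distrib, Finset.sum_filter, Finset.sum_filter]
    simp only [Pi.single_apply]
    congr 1
    · rw [Finset.sum_eq_single a] <;> simp +contextual [eq_comm]
    · rw [Finset.sum_eq_single (rev a)] <;> simp +contextual [eq_comm]
  have h4 : ψ h = c a - c (rev a) := by
    simp [ψ, h, mul_sub, Finset.sum_sub_distrib, Pi.single_apply]
  rw [LinearMap.dualMap_apply, h3, h4, map_sub] at h2
  exact h2.symm

end CycleSpace

/-! ### Turning about a vertex, and first returns to a set of darts -/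

namespace CellularSphere

variable {E : Type*} (S : CellularSphere E) (A : Set E)

theorem vertex_eq_iff {a b : E} : S.vertex a = S.vertex b ↔ S.rot.SameCycle a b :=
  Quotient.eq (r := Equiv.Perm.SameCycle.setoid S.rot)

theorem vertex_surjective : Function.Surjective S.vertex := Quotient.mk_surjective

theorem face_surjective : Function.Surjective S.face := Quotient.mk_surjective

theorem vertex_rot_pow (n : ℕ) (a : E) : S.vertex ((S.rot ^ n) a) = S.vertex a :=
  S.vertex_eq_iff.2 ⟨-(n : ℤ), by simp⟩

theorem vertex_rot (a : E) : S.vertex (S.rot a) = S.vertex a := S.vertex_rot_pow 1 a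

theorem face_next (a : E) : S.face (S.rot⁻¹ (S.rev a)) = S.face a :=
  Quotient.sound (s := Equiv.Perm.SameCycle.setoid (S.rot⁻¹ * S.rev)) ⟨-1, by simp⟩

/-- The corner after `a` lies to the right of the next dart. -/
theorem face_rev_rot (a : E) : S.face (S.rev (S.rot a)) = S.face a := by
  rw [← S.face_next (S.rev (S.rot a)), S.rev_rev]; simp

/-- Functions on the darts which are constant along face boundaries descend to faces. -/
theorem exists_face_eq {α : Type*} [Finite E] (f : E → α)
    (hf : ∀ a, f (S.rot⁻¹ (S.rev a)) = f a) :
    ∃ g : S.Face → α, ∀ a, g (S.face a) = f a := by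
  have hpow : ∀ (n : ℕ) a, f (((S.rot⁻¹ * S.rev) ^ n) a) = f a := by
    intro n a
    induction n with
    | zero => rfl
    | succ n ih => rw [pow_succ', Equiv.Perm.mul_apply, Equiv.Perm.mul_apply, hf, ih]
  refine ⟨Quotient.lift f ?_, fun a => rfl⟩
  intro a b hab
  obtain ⟨n, hn⟩ := Equiv.Perm.SameCycle.exists_nat_pow_eq (f := S.rot⁻¹ * S.rev) hab
  rw [← hn, hpow]

variable [Finite E]

theorem exists_pow_of_vertex_eq {a b : E} (h : S.vertex a = S.vertex b) :
    ∃ n : ℕ, 0 < n ∧ (S.rot ^ n) a = b := by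
  obtain ⟨n, hn, -, h'⟩ := (S.vertex_eq_iff.1 h).exists_pow_eq''
  exact ⟨n, hn, h'⟩

/-- The description of `turn` as a first return. -/
theorem turn_spec {a : E} (ha : a ∈ A) : ∃ k : ℕ, 0 < k ∧ S.turn A a = (S.rot ^ k) a ∧
    (S.rot ^ k) a ∈ A ∧ ∀ j, 0 < j → j < k → (S.rot ^ j) a ∉ A := by
  have hne : {k : ℕ | 0 < k ∧ (S.rot ^ k) a ∈ A}.Nonempty := by
    obtain ⟨n, hn, h⟩ := S.exists_pow_of_vertex_eq (rfl : S.vertex a = S.vertex a)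
    exact ⟨n, hn, by rwa [h]⟩
  refine ⟨sInf {k : ℕ | 0 < k ∧ (S.rot ^ k) a ∈ A}, (Nat.sInf_mem hne).1, rfl, (Nat.sInf_mem hne).2,
    fun j hj hj' hm => ?_⟩
  exact Nat.notMem_of_lt_sInf hj' ⟨hj, hm⟩

theorem turn_mem {a : E} (ha : a ∈ A) : S.turn A a ∈ A := by
  obtain ⟨k, -, h, h', -⟩ := S.turn_spec A ha
  rwa [h]

theorem vertex_turn {a : E} (ha : a ∈ A) : S.vertex (S.turn A a) = S.vertex a := by
  obtain ⟨k, -, h, -, -⟩ := S.turn_spec A ha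
  rw [h, vertex_rot_pow]

theorem exists_turn_iterate {a b : E} (ha : a ∈ A) (hb : b ∈ A) (h : S.vertex a = S.vertex b) :
    ∃ j : ℕ, (S.turn A)^[j] a = b := by
  obtain ⟨n, -, hn⟩ := S.exists_pow_of_vertex_eq h
  clear h
  induction n using Nat.strong_induction_on generalizing a with
  | _ n ih =>
    rcases Nat.eq_zero_or_pos n with rfl | hpos
    · exact ⟨0, hn⟩
    · obtain ⟨k, hk, h1, h2, h3⟩ := S.turn_spec A ha
      have hkn : k ≤ n := by
        by_contra hlt
        exact h3 n hpos (by omega) (hn ▸ hb)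
      obtain ⟨j, hj⟩ := ih (n - k) (by omega) (S.turn_mem A ha) (by
        rw [h1, ← Equiv.Perm.mul_apply, ← pow_add, Nat.sub_add_cancel hkn, hn])
      exact ⟨j + 1, by rw [Function.iterate_succ_apply, hj]⟩

/-- The darts of `A` at the vertex of `a` are the iterates of `turn` on `a`, and there are as many
as the degree says. -/
theorem turn_cycle {a : E} (ha : a ∈ A) {m : ℕ} (hm : S.degree A (S.vertex a) = m) :
    (S.turn A)^[m] a = a ∧ (∀ i < m, ∀ j < m, (S.turn A)^[i] a = (S.turn A)^[j] a → i = j) ∧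
      ∀ b ∈ A, S.vertex b = S.vertex a → ∃ i < m, (S.turn A)^[i] a = b := by
  classical
  let Y := {b : E // b ∈ A ∧ S.vertex b = S.vertex a}
  let t : Y → Y := fun b => ⟨S.turn A b.1, S.turn_mem A b.2.1, (S.vertex_turn A b.2.1).trans b.2.2⟩
  have ht : ∀ n (b : Y), (t^[n] b).1 = (S.turn A)^[n] b.1 := by
    intro n b
    induction n with
    | zero => rfl
    | succ n ih => rw [Function.iterate_succ_apply', Function.iterate_succ_apply', ← ih]
  have htrans : ∀ b c : Y, ∃ j, t^[j] b = c := by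
    intro b c
    obtain ⟨j, hj⟩ := S.exists_turn_iterate A b.2.1 c.2.1 (b.2.2.trans c.2.2.symm)
    exact ⟨j, Subtype.ext (by rw [ht, hj])⟩
  -- The map `turn` acts transitively on the finite set `Y`, so it is one cycle, whose length is the
  -- degree.
  have hcard : Nat.card Y = m := hm
  let a' : Y := ⟨a, ha, rfl⟩
  have hper : a' ∈ Function.periodicPts t := by
    obtain ⟨j, hj⟩ := htrans (t a') a'
    exact ⟨j + 1, Nat.succ_pos _, by rw [Function.IsPeriodicPt, Function.IsFixedPt,
      Function.iterate_succ_apply, hj]⟩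
  have hpos := Function.minimalPeriod_pos_of_mem_periodicPts hper
  let e : Fin (Function.minimalPeriod t a') → Y := fun i => t^[i] a'
  have he : Function.Bijective e := by
    constructor
    · intro i j hij
      ext
      exact Function.iterate_injOn_Iio_minimalPeriod (f := t) (x := a') i.2 j.2 hij
    · intro b
      obtain ⟨j, hj⟩ := htrans a' b
      refine ⟨⟨j % Function.minimalPeriod t a', Nat.mod_lt _ hpos⟩, ?_⟩
      simp only [e]
      rw [Function.iterate_mod_minimalPeriod_eq, hj]
  have hmp : Function.minimalPeriod t a' = m := by
    rw [← hcard, ← Nat.card_eq_of_bijective e he, Nat.card_fin]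
  refine ⟨?_, ?_, ?_⟩
  · have := Function.isPeriodicPt_minimalPeriod t a'
    rw [hmp] at this
    have h2 := congrArg Subtype.val this
    rwa [ht] at h2
  · intro i hi j hj hij
    rw [← hmp] at hi hj
    refine Function.iterate_injOn_Iio_minimalPeriod (f := t) (x := a') hi hj (Subtype.ext ?_)
    dsimp only
    rw [ht, ht]; exact hij
  · intro b hb hb'
    obtain ⟨i, hi⟩ := he.2 ⟨b, hb, hb'⟩
    refine ⟨i, hmp ▸ i.2, ?_⟩
    rw [← ht i a']
    exact congrArg Subtype.val hi

/-- The first return to `A` going back from a dart. -/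
theorem exists_mem_before {a : E} (hA : ∃ b ∈ A, S.vertex b = S.vertex a) : ∃ b ∈ A, ∃ n : ℕ,
    (S.rot ^ n) b = a ∧ ∀ j, 0 < j → j ≤ n → (S.rot ^ j) b ∉ A := by
  classical
  obtain ⟨b, hb, hv⟩ := hA
  obtain ⟨n, -, hn⟩ := S.exists_pow_of_vertex_eq hv
  induction n using Nat.strong_induction_on generalizing b with
  | _ n ih =>
    by_cases h : ∃ j, 0 < j ∧ j ≤ n ∧ (S.rot ^ j) b ∈ A
    · obtain ⟨j, hj, hjn, hm⟩ := h
      refine ih (n - j) (by omega) _ hm (by rw [vertex_rot_pow, hv]) ?_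
      rw [← Equiv.Perm.mul_apply, ← pow_add, Nat.sub_add_cancel hjn, hn]
    · push Not at h
      exact ⟨b, hb, n, hn, h⟩

end CellularSphere

/-! ### Vanishing of the first cohomology of the sphere -/

namespace CellularSphere

variable {E : Type*} (S : CellularSphere E)

theorem eq_of_rot_rev_invariant {α : Type*} (f : E → α) (h1 : ∀ a, f (S.rot a) = f a)
    (h2 : ∀ a, f (S.rev a) = f a) (a b : E) : f a = f b := by
  have := S.connected a b
  induction this with
  | rel _ _ h =>
    rcases h with rfl | rfl
    · exact (h1 _).symm
    · exact (h2 _).symm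
  | refl => rfl
  | symm _ _ _ ih => exact ih.symm
  | trans _ _ _ _ _ ih1 ih2 => exact ih1.trans ih2

/-- A function on the faces without jumps is constant. -/
theorem face_eq_of_no_jump {α : Type*} (f : S.Face → α)
    (h : ∀ a, f (S.face a) = f (S.face (S.rev a))) (a b : E) : f (S.face a) = f (S.face b) :=
  S.eq_of_rot_rev_invariant (fun a => f (S.face a))
    (fun a => by rw [h (S.rot a), face_rev_rot]) (fun a => (h a).symm) a b

variable [Finite E]

theorem card_edges : Nat.card (Quotient (Equiv.Perm.SameCycle.setoid S.rev)) =
    Nat.card (Quot fun a b => b = S.rev a) := by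
  symm
  refine Nat.card_eq_of_bijective
    (Quot.lift (fun a => (Quotient.mk (Equiv.Perm.SameCycle.setoid S.rev) a)) ?_) ⟨?_, ?_⟩
  · rintro a _ rfl
    exact Quotient.sound (s := Equiv.Perm.SameCycle.setoid S.rev) ⟨1, by simp⟩
  · intro x y hxy
    induction x using Quot.ind with | mk a =>
    induction y using Quot.ind with | mk b =>
    obtain ⟨n, hn⟩ := Equiv.Perm.SameCycle.exists_nat_pow_eq (f := S.rev)
      (Quotient.exact (s := Equiv.Perm.SameCycle.setoid S.rev) hxy)
    clear hxy
    induction n generalizing a with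
    | zero => rw [← hn]; rfl
    | succ n ih =>
      rw [← ih (S.rev a) (by rwa [pow_succ, Equiv.Perm.mul_apply] at hn)]
      exact Quot.sound rfl
  · intro q
    induction q using Quotient.ind with | _ a => exact ⟨Quot.mk _ a, rfl⟩

theorem nonempty_of_euler {E : Type*} (S : CellularSphere E) : Nonempty E := by
  by_contra h
  rw [not_nonempty_iff] at h
  have := S.euler
  have e1 : Nat.card S.Vertex = 0 := by
    rw [Nat.card_eq_zero]; exact Or.inl ⟨fun q => h.elim q.out⟩
  have e2 : Nat.card S.Face = 0 := by
    rw [Nat.card_eq_zero]; exact Or.inl ⟨fun q => h.elim q.out⟩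
  unfold Vertex at e1
  unfold Face at e2
  omega

-- Each corner at `v` lies to the left of one dart and to the right of the next, so the sum cancels
-- around the vertex.
open Classical in
theorem sum_jump_eq_zero {E : Type*} (S : CellularSphere E) (k : Type*) [Field k] [Fintype E]
    (f : S.Face → k) (v : S.Vertex) :
    ∑ a with S.vertex a = v, (f (S.face a) - f (S.face (S.rev a))) = 0 := by
  rw [Finset.sum_sub_distrib, sub_eq_zero]
  refine Finset.sum_equiv S.rot (fun a => ?_) (fun a _ => by rw [face_rev_rot])
  simp [vertex_rot]

/-- The jumps of a function on the faces of a cell structure. -/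
def jump (k : Type*) [Field k] : (S.Face → k) →ₗ[k] (E → k) where
  toFun f a := f (S.face a) - f (S.face (S.rev a))
  map_add' f g := by ext a; simp only [Pi.add_apply]; ring
  map_smul' c f := by ext a; simp [mul_sub]

/-- The first cohomology of the sphere vanishes, in terms of the dual cell structure. -/
theorem range_jump (k : Type*) [Field k] [Fintype E] :
    LinearMap.range (S.jump k) = cycleSpace k S.rev S.vertex := by
  obtain ⟨a₀⟩ := S.nonempty_of_euler
  apply Submodule.eq_of_le_of_finrank_eq
  · rintro _ ⟨f, rfl⟩
    refine ⟨fun a => ?_, fun v => by convert S.sum_jump_eq_zero k f v; rfl⟩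
    simp only [jump, LinearMap.coe_mk, AddHom.coe_mk, S.rev_rev]
    ring
  -- Jumps are cycles, so it is enough to compare dimensions: F - 1 for the jumps and E - V + 1 for
  -- the cycles. These agree by Euler's formula.
  · have hker : LinearMap.ker (S.jump k) = Submodule.span k {fun _ => (1 : k)} := by
      ext f
      rw [LinearMap.mem_ker, Submodule.mem_span_singleton]
      constructor
      · intro h
        refine ⟨f (S.face a₀), ?_⟩
        ext x
        obtain ⟨a, rfl⟩ := S.face_surjective x
        simp only [Pi.smul_apply, smul_eq_mul, mul_one]
        exact S.face_eq_of_no_jump f (fun a => sub_eq_zero.1 (congrFun h a)) _ _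
      · rintro ⟨c, rfl⟩
        ext a
        simp [jump]
    have hne : (fun _ : S.Face => (1 : k)) ≠ 0 := fun h => one_ne_zero (congrFun h (S.face a₀))
    have r1 := LinearMap.finrank_range_add_finrank_ker (S.jump k)
    rw [hker, finrank_span_singleton hne] at r1
    have : Fintype S.Face := Fintype.ofFinite _
    rw [Module.finrank_fintype_fun_eq_card, ← Nat.card_eq_fintype_card] at r1
    have r2 := finrank_cycleSpace k S.rev S.vertex S.rev_rev S.rev_ne S.vertex_surjective
    have r3 : Nat.card (Quot fun a b => b = S.rev a ∨ S.vertex b = S.vertex a) = 1 := by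
      rw [Nat.card_eq_one_iff_unique]
      refine ⟨⟨fun x y => ?_⟩, ⟨Quot.mk _ a₀⟩⟩
      induction x using Quot.ind with | mk a =>
      induction y using Quot.ind with | mk b =>
      let r : E → E → Prop := fun a b => b = S.rev a ∨ S.vertex b = S.vertex a
      exact S.eq_of_rot_rev_invariant (Quot.mk r)
        (fun a => (Quot.sound (r := r) (Or.inr (S.vertex_rot a))).symm)
        (fun a => (Quot.sound (r := r) (Or.inl rfl)).symm) a b
    have r4 := S.euler
    rw [S.card_edges] at r4
    change Nat.card S.Vertex + Nat.card S.Face = _ at r4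
    omega

open Classical in
/-- A cycle of a subgraph is the jump of a function on the faces. -/
theorem exists_potential (k : Type*) [Field k] [Fintype E] (P : Set E) (hP : ∀ a ∈ P, S.rev a ∈ P)
    (h : P → k) (h1 : ∀ a (ha : a ∈ P), h ⟨S.rev a, hP a ha⟩ = -h ⟨a, ha⟩)
    (h2 : ∀ v, ∑ a : P with S.vertex a.1 = v, h a = 0) :
    ∃ f : S.Face → k, (∀ a : P, f (S.face a) - f (S.face (S.rev a)) = h a) ∧
      ∀ a ∉ P, f (S.face a) = f (S.face (S.rev a)) := by
  have hP' : ∀ a, S.rev a ∈ P ↔ a ∈ P := fun a => ⟨fun h => by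
    have := hP _ h; rwa [S.rev_rev] at this, hP a⟩
  -- A cycle of the subgraph, extended by zero, is a cycle of the whole graph; its potential does
  -- not jump across the edges outside `P`.
  let h' : E → k := fun a => if ha : a ∈ P then h ⟨a, ha⟩ else 0
  have hmem : h' ∈ cycleSpace k S.rev S.vertex := by
    refine ⟨fun a => ?_, fun v => ?_⟩
    · by_cases ha : a ∈ P
      · simp only [h', dif_pos ha, dif_pos (hP a ha), h1 a ha]
      · simp only [h', dif_neg ha, dif_neg (mt (hP' a).1 ha), neg_zero]
    · rw [← h2 v]
      symm
      refine Finset.sum_bij_ne_zero (fun a _ _ => a.1) ?_ ?_ ?_ ?_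
      · intro a ha _
        simpa using ha
      · intro a _ _ b _ _ hab
        exact Subtype.ext hab
      · intro b hb hb0
        by_cases hbP : b ∈ P
        · exact ⟨⟨b, hbP⟩, by simpa using hb, by simpa [h', hbP] using hb0, rfl⟩
        · simp [h', hbP] at hb0
      · intro a _ _
        simp [h']
  rw [← S.range_jump k] at hmem
  obtain ⟨f, hf⟩ := hmem
  refine ⟨f, fun a => ?_, fun a ha => ?_⟩
  · refine (congrFun hf a).trans ?_
    simp [h']
  · refine sub_eq_zero.1 ((congrFun hf a).trans ?_)
    simp [h', ha]

end CellularSphere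

/-! ### Regions of the diagram and their potentials -/

namespace LinkDiagram

variable {E : Type*} (D : LinkDiagram E)

theorem region_surjective : Function.Surjective D.region := by
  intro R
  induction R using Quot.ind with | mk F =>
  obtain ⟨a, rfl⟩ := D.face_surjective F
  exact ⟨a, rfl⟩

theorem region_rev {a : E} (ha : a ∉ D.darts) : D.region (D.rev a) = D.region a :=
  (Quot.sound ⟨a, ha, rfl, rfl⟩).symm

theorem region_rev_rot (a : E) : D.region (D.rev (D.rot a)) = D.region a :=
  congrArg (Quot.mk _) (D.face_rev_rot a)

theorem region_next (a : E) : D.region (D.rot⁻¹ (D.rev a)) = D.region a :=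
  congrArg (Quot.mk _) (D.face_next a)

theorem region_rot_pow {a : E} (n : ℕ) (h : ∀ j, 0 < j → j ≤ n → (D.rot ^ j) a ∉ D.darts) :
    D.region ((D.rot ^ n) a) = D.region a := by
  induction n with
  | zero => rfl
  | succ n ih =>
    rw [← ih fun j h1 h2 => h j h1 (by omega), ← D.region_rev (h (n + 1) (by omega) le_rfl),
      pow_succ', Equiv.Perm.mul_apply, region_rev_rot]

/-- A function on the regions without jumps is constant. -/
theorem region_eq_of_no_jump {α : Type*} (u : D.Region → α)
    (h : ∀ a ∈ D.darts, u (D.region a) = u (D.region (D.rev a))) (R R' : D.Region) :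
    u R = u R' := by
  obtain ⟨a, rfl⟩ := D.region_surjective R
  obtain ⟨b, rfl⟩ := D.region_surjective R'
  refine D.face_eq_of_no_jump (fun F => u (Quot.mk _ F)) (fun a => ?_) a b
  by_cases ha : a ∈ D.darts
  · exact h a ha
  · exact congrArg u (D.region_rev ha).symm

variable [Finite E]

/-- Functions on the darts which are constant along faces and across edges outside the diagram
descend to regions. -/
theorem exists_region_eq {α : Type*} (f : E → α) (h1 : ∀ a, f (D.rot⁻¹ (D.rev a)) = f a)
    (h2 : ∀ a ∉ D.darts, f (D.rev a) = f a) : ∃ u : D.Region → α, ∀ a, u (D.region a) = f a := by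
  obtain ⟨g, hg⟩ := D.exists_face_eq f h1
  refine ⟨Quot.lift g ?_, hg⟩
  rintro _ _ ⟨a, ha, rfl, rfl⟩
  rw [hg, hg, h2 a ha]

theorem region_rev_turn {a : E} (ha : a ∈ D.darts) :
    D.region (D.rev (D.turn D.darts a)) = D.region a := by
  obtain ⟨k, hk, h1, -, h2⟩ := D.turn_spec D.darts ha
  obtain ⟨n, rfl⟩ : ∃ n, k = n + 1 := ⟨k - 1, by omega⟩
  rw [h1, pow_succ', Equiv.Perm.mul_apply, region_rev_rot]
  exact D.region_rot_pow n fun j h3 h4 => h2 j h3 (by omega)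

/-- Every corner at a vertex on the diagram belongs to the region after a dart of the diagram. -/
theorem exists_dart_region {a : E} (hA : ∃ b ∈ D.darts, D.vertex b = D.vertex a) :
    ∃ b ∈ D.darts, D.vertex b = D.vertex a ∧ D.region b = D.region a := by
  obtain ⟨b, hb, n, rfl, h⟩ := D.exists_mem_before D.darts hA
  exact ⟨b, hb, (D.vertex_rot_pow n b).symm, (D.region_rot_pow n h).symm⟩

open Classical in
/-- A cycle of the projection image is the jump of a function on the regions. -/
theorem exists_region_potential (k : Type*) [Field k] [Fintype E] (h : D.darts → k)
    (h1 : ∀ a (ha : a ∈ D.darts), h ⟨D.rev a, D.rev_mem a ha⟩ = -h ⟨a, ha⟩)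
    (h2 : ∀ v, ∑ a : D.darts with D.vertex a.1 = v, h a = 0) :
    ∃ u : D.Region → k, ∀ a : D.darts, u (D.region a) - u (D.region (D.rev a)) = h a := by
  obtain ⟨f, hf, hf'⟩ := D.exists_potential k D.darts D.rev_mem h h1 h2
  refine ⟨Quot.lift f ?_, hf⟩
  rintro _ _ ⟨a, ha, rfl, rfl⟩
  exact hf' a ha

open Classical in
theorem sum_region_jump_eq_zero {E : Type*} (D : LinkDiagram E) (k : Type*) [Field k]
    [Fintype E] (u : D.Region → k)
    (v : D.Vertex) :
    ∑ a : D.darts with D.vertex a.1 = v, (u (D.region a) - u (D.region (D.rev a))) = 0 := by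
  rw [← D.sum_jump_eq_zero k (fun F => u (Quot.mk _ F)) v]
  refine Finset.sum_bij_ne_zero (fun a _ _ => a.1) ?_ ?_ ?_ ?_
  · intro a ha _
    simpa using ha
  · intro a _ _ b _ _ hab
    exact Subtype.ext hab
  · intro b hb hb0
    by_cases hbP : b ∈ D.darts
    · exact ⟨⟨b, hbP⟩, by simpa using hb, hb0, rfl⟩
    · exact absurd (sub_eq_zero.2 (congrArg u (D.region_rev hbP).symm)) hb0
  · intro a _ _
    rfl

end LinkDiagram

theorem finrank_comap_of_le_range {k M N : Type*} [Field k] [AddCommGroup M] [Module k M]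
    [AddCommGroup N] [Module k N] [FiniteDimensional k M] (f : M →ₗ[k] N) (C : Submodule k N)
    (hC : C ≤ LinearMap.range f) :
    Module.finrank k (C.comap f) = Module.finrank k C + Module.finrank k (LinearMap.ker f) := by
  have h := LinearMap.finrank_range_add_finrank_ker (f.domRestrict (C.comap f))
  have hle : LinearMap.ker f ≤ C.comap f := LinearMap.ker_le_comap f
  rw [LinearMap.range_domRestrict, Submodule.map_comap_eq_of_le hC, LinearMap.ker_domRestrict] at h
  rw [← h, ← (Submodule.comapSubtypeEquivOfLe hle).finrank_eq]

namespace LinkDiagram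

variable {E : Type*} (D : LinkDiagram E)

/-- The next dart of the diagram, counterclockwise about the initial vertex. -/
noncomputable def next (a : E) : E := D.turn D.darts a

/-- Reversal of the darts of the diagram. -/
def revDart (a : D.darts) : D.darts := ⟨D.rev a, D.rev_mem a a.2⟩

theorem revDart_revDart (a : D.darts) : D.revDart (D.revDart a) = a :=
  Subtype.ext (D.rev_rev a)

theorem revDart_ne (a : D.darts) : D.revDart a ≠ a := fun h => D.rev_ne a (congrArg Subtype.val h)

/-- The jumps of a function on the regions across the edges of the diagram. -/
def regionJump (k : Type*) [Field k] : (D.Region → k) →ₗ[k] (D.darts → k) where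
  toFun u a := u (D.region a) - u (D.region (D.rev a))
  map_add' f g := by ext a; simp only [Pi.add_apply]; ring
  map_smul' c f := by ext a; simp [mul_sub]

theorem finrank_ker_regionJump (k : Type*) [Field k] :
    Module.finrank k (LinearMap.ker (D.regionJump k)) = 1 := by
  obtain ⟨a₀⟩ := D.nonempty_of_euler
  have hker : LinearMap.ker (D.regionJump k) = Submodule.span k {fun _ => (1 : k)} := by
    ext f
    rw [LinearMap.mem_ker, Submodule.mem_span_singleton]
    constructor
    · intro h
      refine ⟨f (D.region a₀), ?_⟩
      ext x
      simp only [Pi.smul_apply, smul_eq_mul, mul_one]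
      exact D.region_eq_of_no_jump f (fun a ha => sub_eq_zero.1 (congrFun h ⟨a, ha⟩)) _ _
    · rintro ⟨c, rfl⟩
      ext a
      simp [regionJump]
  have hne : (fun _ : D.Region => (1 : k)) ≠ 0 := fun h => one_ne_zero (congrFun h (D.region a₀))
  rw [hker, finrank_span_singleton hne]

variable [Finite E]

theorem next_mem {a : E} (ha : a ∈ D.darts) : D.next a ∈ D.darts := D.turn_mem _ ha

theorem vertex_next {a : E} (ha : a ∈ D.darts) : D.vertex (D.next a) = D.vertex a :=
  D.vertex_turn _ ha

theorem region_rev_next {a : E} (ha : a ∈ D.darts) : D.region (D.rev (D.next a)) = D.region a :=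
  D.region_rev_turn ha

theorem degree_ne_zero {a : E} (ha : a ∈ D.darts) : D.degree D.darts (D.vertex a) ≠ 0 := by
  have : Nonempty {b : E // b ∈ D.darts ∧ D.vertex b = D.vertex a} := ⟨⟨a, ha, rfl⟩⟩
  exact Nat.card_pos.ne'

theorem degree_eq_two {a : E} (ha : a ∈ D.darts) (h : D.degree D.darts (D.vertex a) ≠ 4) :
    D.degree D.darts (D.vertex a) = 2 := by
  have := D.degree_eq (D.vertex a)
  have := D.degree_ne_zero ha
  tauto

section Two

variable {a : E} (ha : a ∈ D.darts) (h : D.degree D.darts (D.vertex a) = 2)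
include ha h

theorem next_next : D.next (D.next a) = a := (D.turn_cycle _ ha h).1

theorem next_ne_of_two : D.next a ≠ a := fun h' => by
  have := (D.turn_cycle _ ha h).2.1 1 (by omega) 0 (by omega) h'
  omega

end Two

section Four

variable {a : E} (ha : a ∈ D.darts) (h : D.degree D.darts (D.vertex a) = 4)
include ha h

theorem next_four : D.next (D.next (D.next (D.next a))) = a := (D.turn_cycle _ ha h).1

theorem next_iterate_ne {i j : ℕ} (hi : i < 4) (hj : j < 4) (hij : i ≠ j) :
    D.next^[i] a ≠ D.next^[j] a := fun h' => hij ((D.turn_cycle _ ha h).2.1 i hi j hj h')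

theorem eq_next_of_vertex_eq {b : E} (hb : b ∈ D.darts) (hv : D.vertex b = D.vertex a) :
    b = a ∨ b = D.next a ∨ b = D.next (D.next a) ∨ b = D.next (D.next (D.next a)) := by
  obtain ⟨i, hi, rfl⟩ := (D.turn_cycle _ ha h).2.2 b hb hv
  have : i = 0 ∨ i = 1 ∨ i = 2 ∨ i = 3 := by omega
  rcases this with rfl | rfl | rfl | rfl
  · exact Or.inl rfl
  · exact Or.inr (Or.inl rfl)
  · exact Or.inr (Or.inr (Or.inl rfl))
  · exact Or.inr (Or.inr (Or.inr rfl))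

theorem region_rev_eq : D.region (D.rev a) = D.region (D.next (D.next (D.next a))) := by
  conv_lhs => rw [← D.next_four ha h]
  exact D.region_rev_next (D.next_mem (D.next_mem (D.next_mem ha)))

end Four

theorem region_rev_eq_of_two {a : E} (ha : a ∈ D.darts)
    (h : D.degree D.darts (D.vertex a) = 2) : D.region (D.rev a) = D.region (D.next a) := by
  conv_lhs => rw [← D.next_next ha h]
  exact D.region_rev_next (D.next_mem ha)

/-! ### Counting regions -/

/-- The vertex set is restricted to the vertices on the diagram because `finrank_cycleSpace` counts
components by darts and needs every vertex to carry one. -/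
theorem range_regionJump (k : Type*) [Field k] [Fintype D.darts] :
    LinearMap.range (D.regionJump k) = cycleSpace k D.revDart
      (Set.rangeFactorization fun a : D.darts => D.vertex a.1) := by
  classical
  have := Fintype.ofFinite E
  have hsum : ∀ (h : D.darts → k) (w : Set.range fun a : D.darts => D.vertex a.1),
      ∑ a with (Set.rangeFactorization fun a : D.darts => D.vertex a.1) a = w, h a =
      ∑ a : D.darts with D.vertex a.1 = w.1, h a := by
    intro h w
    refine Finset.sum_congr ?_ fun _ _ => rfl
    ext a
    simp [Subtype.ext_iff]
  ext h
  constructor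
  · rintro ⟨u, rfl⟩
    refine ⟨fun a => ?_, fun w => ?_⟩
    · simp [regionJump, revDart, D.rev_rev]
    · have := D.sum_region_jump_eq_zero k u w.1
      have h2 := hsum (D.regionJump k u) w
      convert h2.trans _
      convert this
      rfl
  · rintro ⟨h1, h2⟩
    obtain ⟨u, hu⟩ := D.exists_region_potential k h (fun a ha => h1 ⟨a, ha⟩) (fun v => by
      by_cases hv : v ∈ Set.range fun a : D.darts => D.vertex a.1
      · have h3 := hsum h ⟨v, hv⟩
        have h4 := h2 ⟨v, hv⟩
        convert h3.symm.trans _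
        convert h4
      · rw [Finset.filter_false_of_mem, Finset.sum_empty]
        intro a _ ha
        exact hv ⟨a, ha⟩)
    exact ⟨u, funext hu⟩

/-- Handshake count: a vertex of degree 2 contributes 2, and a crossing contributes 2 twice. -/
theorem card_darts : Nat.card D.darts =
    2 * Nat.card (Set.range fun a : D.darts => D.vertex a.1) + 2 * Nat.card D.Crossing := by
  classical
  have := Fintype.ofFinite E
  have : Fintype D.Vertex := Fintype.ofFinite _
  have h1 : Nat.card D.darts = ∑ v, D.degree D.darts v := by
    have e : (Σ v, {a : E // a ∈ D.darts ∧ D.vertex a = v}) ≃ D.darts :=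
      { toFun := fun x => ⟨x.2.1, x.2.2.1⟩
        invFun := fun a => ⟨D.vertex a.1, a.1, a.2, rfl⟩
        left_inv := by rintro ⟨_, a, ha, rfl⟩; rfl
        right_inv := fun a => rfl }
    rw [← Nat.card_congr e, Nat.card_sigma]
    rfl
  have h2 : Nat.card (Set.range fun a : D.darts => D.vertex a.1) =
      ∑ v, if D.degree D.darts v ≠ 0 then 1 else 0 := by
    rw [← Finset.card_filter, Nat.card_eq_card_toFinset]
    congr 1
    ext v
    simp only [Set.mem_toFinset, Finset.mem_filter, Finset.mem_univ, true_and]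
    constructor
    · rintro ⟨a, rfl⟩
      exact D.degree_ne_zero a.2
    · intro hv
      have : Nonempty {a : E // a ∈ D.darts ∧ D.vertex a = v} := by
        by_contra hne
        rw [not_nonempty_iff] at hne
        exact hv (Nat.card_of_isEmpty)
      obtain ⟨a, ha, hv⟩ := this
      exact ⟨⟨a, ha⟩, hv⟩
  have h3 : Nat.card D.Crossing = ∑ v, if D.degree D.darts v = 4 then 1 else 0 := by
    rw [← Finset.card_filter]
    exact Nat.subtype_card _ (by simp)
  rw [h1, h2, h3, Finset.mul_sum, Finset.mul_sum, ← Finset.sum_add_distrib]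
  refine Finset.sum_congr rfl fun v _ => ?_
  rcases D.degree_eq v with h | h | h <;> simp [h]

/-- Regions exceed the dimension E - V + d of the cycle space by one, for the constants, and E - V
is the number of crossings by the handshake count. -/
theorem card_region : Nat.card D.Region = Nat.card D.Crossing + Nat.card D.ConnComp + 1 := by
  classical
  have := Fintype.ofFinite D.darts
  have h1 := LinearMap.finrank_range_add_finrank_ker (D.regionJump ℚ)
  rw [D.finrank_ker_regionJump, D.range_regionJump, Module.finrank_fintype_fun_eq_card,
    ← Nat.card_eq_fintype_card] at h1
  have h2 := finrank_cycleSpace ℚ D.revDart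
    (Set.rangeFactorization fun a : D.darts => D.vertex a.1) D.revDart_revDart D.revDart_ne
    Set.rangeFactorization_surjective
  have h3 := two_mul_card_quot_involution D.revDart D.revDart_revDart D.revDart_ne
  have h4 := D.card_darts
  have h5 : Nat.card D.ConnComp = Nat.card (Quot fun a b => b = D.revDart a ∨
      (Set.rangeFactorization fun a : D.darts => D.vertex a.1) b =
      (Set.rangeFactorization fun a : D.darts => D.vertex a.1) a) := by
    unfold ConnComp
    congr! 3 with a
    funext b
    rw [Subtype.ext_iff, Subtype.ext_iff (a1 := Set.rangeFactorization _ b)]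
    rfl
  omega

/-! ### The checkerboard colouring -/

theorem exists_checkerboard : ∃ ε : D.Region → ℤ, (∀ R, ε R * ε R = 1) ∧
    ∀ a ∈ D.darts, ε (D.region (D.rev a)) = -ε (D.region a) := by
  classical
  have := Fintype.ofFinite E
  -- The constant 1 is a cycle modulo 2: 1 = -1, and every degree is even. Its potential changes
  -- across each edge of the diagram.
  obtain ⟨u, hu⟩ := D.exists_region_potential (ZMod 2) (fun _ => 1) (fun a ha => by decide)
    (fun v => by
      rw [Finset.sum_const, nsmul_one, ← Fintype.card_subtype]
      have e : {a : D.darts // D.vertex a.1 = v} ≃ {a : E // a ∈ D.darts ∧ D.vertex a = v} :=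
        Equiv.subtypeSubtypeEquivSubtypeInter (· ∈ D.darts) (D.vertex · = v)
      have hd := D.degree_eq v
      unfold CellularSphere.degree at hd
      rw [← Nat.card_eq_fintype_card, Nat.card_congr e]
      rcases hd with h | h | h <;> rw [h] <;> rfl)
  have h2 : ∀ x : ZMod 2, x = 0 ∨ x = 1 := by decide
  refine ⟨fun R => if u R = 0 then 1 else -1, fun R => ?_, fun a ha => ?_⟩
  · dsimp only; split_ifs <;> rfl
  · have h3 := hu ⟨a, ha⟩
    dsimp only at h3 ⊢
    rcases h2 (u (D.region a)) with h | h <;> rcases h2 (u (D.region (D.rev a))) with h' | h' <;>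
      rw [h, h'] at h3 <;> simp_all

end LinkDiagram

/-! ### Link components and the jumps constant along them -/

/-- Two involutions without fixed points have a common sign on each joint orbit. -/
theorem exists_common_orientation (k : Type*) [Field k] {X : Type*} (r s : X → X)
    (hr : ∀ a, r (r a) = a) (hs : ∀ a, s (s a) = a) (hr' : ∀ a, r a ≠ a) (hs' : ∀ a, s a ≠ a)
    (a : X) : ∃ h : X → k, (∀ b, h (r b) = -h b) ∧ (∀ b, h (s b) = -h b) ∧ h a = 1 := by
  classical
  let r' : Equiv.Perm X := ⟨r, r, hr, hr⟩
  let s' : Equiv.Perm X := ⟨s, s, hs, hs⟩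
  let σ : Equiv.Perm X := r' * s'
  have hσ : ∀ b, σ b = r (s b) := fun _ => rfl
  have hσi : ∀ b, σ⁻¹ b = s (r b) := fun b => by rw [Equiv.Perm.inv_eq_iff_eq, hσ, hs, hr]
  have hsemi : SemiconjBy s' σ σ⁻¹ := by
    ext b
    change s (r (s b)) = σ⁻¹ (s b)
    rw [hσi]
  have hz : ∀ (i : ℤ) b, s ((σ ^ i) b) = (σ ^ (-i)) (s b) := by
    intro i b
    have := congrArg (fun f : Equiv.Perm X => f b) (hsemi.zpow_right i)
    rw [inv_zpow'] at this
    exact this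
  -- Conjugation by `s` inverts `σ`. If `s b = σ ^ i b`, then for even i the map `s` has a fixed
  -- point, and for odd i the map `r` has one. Hence the `σ`-orbit of `a` and its image under `s`
  -- are disjoint and can be given opposite signs.
  have hodd : ∀ b, ¬ (σ.SameCycle a b ∧ σ.SameCycle a (s b)) := by
    rintro b ⟨h1, h2⟩
    obtain ⟨i, hi⟩ := h1.symm.trans h2
    rcases Int.even_or_odd' i with ⟨j, rfl | rfl⟩
    · apply hs' ((σ ^ j) b)
      rw [hz, ← hi, ← Equiv.Perm.mul_apply, ← zpow_add]
      congr 2; ring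
    · apply hr' (s ((σ ^ j) b))
      change σ ((σ ^ j) b) = _
      rw [hz, ← hi, ← Equiv.Perm.mul_apply, ← zpow_one_add, ← Equiv.Perm.mul_apply, ← zpow_add]
      congr 2; ring
  have e1 : ∀ b, σ.SameCycle a (r b) ↔ σ.SameCycle a (s b) := by
    intro b
    have : r b = σ (s b) := by rw [hσ, hs]
    rw [this, Equiv.Perm.sameCycle_apply_right]
  have e2 : ∀ b, σ.SameCycle a (s (r b)) ↔ σ.SameCycle a b := by
    intro b
    rw [← hσi]
    exact Equiv.Perm.sameCycle_symm_apply_right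
  refine ⟨fun b => if σ.SameCycle a b then 1 else if σ.SameCycle a (s b) then -1 else 0,
    fun b => ?_, fun b => ?_, if_pos (Equiv.Perm.SameCycle.refl σ a)⟩
  · have := hodd b
    simp only [e1, e2]
    split_ifs <;> simp_all
  · have := hodd b
    simp only [hs]
    split_ifs <;> simp_all

namespace LinkDiagram

variable {E : Type*} (D : LinkDiagram E)

theorem straight_of_four {a : E} (h : D.degree D.darts (D.vertex a) = 4) :
    D.straight a = D.next (D.next a) := if_pos h

theorem straight_of_two {a : E} (h : D.degree D.darts (D.vertex a) = 2) :
    D.straight a = D.next a := if_neg (by rw [h]; decide)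

variable [Finite E]

theorem straight_mem {a : E} (ha : a ∈ D.darts) : D.straight a ∈ D.darts := by
  by_cases h : D.degree D.darts (D.vertex a) = 4
  · rw [D.straight_of_four h]; exact D.next_mem (D.next_mem ha)
  · rw [D.straight_of_two (D.degree_eq_two ha h)]; exact D.next_mem ha

theorem vertex_straight {a : E} (ha : a ∈ D.darts) : D.vertex (D.straight a) = D.vertex a := by
  by_cases h : D.degree D.darts (D.vertex a) = 4
  · rw [D.straight_of_four h, D.vertex_next (D.next_mem ha), D.vertex_next ha]
  · rw [D.straight_of_two (D.degree_eq_two ha h), D.vertex_next ha]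

/-- Going straight, on the darts of the diagram. -/
noncomputable def straightDart (a : D.darts) : D.darts := ⟨D.straight a, D.straight_mem a.2⟩

theorem straightDart_straightDart (a : D.darts) : D.straightDart (D.straightDart a) = a := by
  obtain ⟨a, ha⟩ := a
  apply Subtype.ext
  change D.straight (D.straight a) = a
  have hv := D.vertex_straight ha
  by_cases h : D.degree D.darts (D.vertex a) = 4
  · rw [D.straight_of_four (hv ▸ h), D.straight_of_four h, D.next_four ha h]
  · have h := D.degree_eq_two ha h
    rw [D.straight_of_two (hv ▸ h), D.straight_of_two h, D.next_next ha h]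

theorem straightDart_ne (a : D.darts) : D.straightDart a ≠ a := by
  obtain ⟨a, ha⟩ := a
  intro h'
  have h' : D.straight a = a := congrArg Subtype.val h'
  by_cases h : D.degree D.darts (D.vertex a) = 4
  · rw [D.straight_of_four h] at h'
    exact D.next_iterate_ne ha h (i := 2) (j := 0) (by omega) (by omega) (by omega) h'
  · have h := D.degree_eq_two ha h
    rw [D.straight_of_two h] at h'
    exact D.next_ne_of_two ha h h'

/-- The functions on the darts which are constant along the oriented components of the link. -/
def linkSpace (k : Type*) [Field k] : Submodule k (D.darts → k) where
  carrier := {h | (∀ a, h (D.revDart a) = -h a) ∧ ∀ a, h (D.straightDart a) = -h a}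
  add_mem' := by
    rintro f g ⟨hf, hf'⟩ ⟨hg, hg'⟩
    refine ⟨fun a => ?_, fun a => ?_⟩
    · simp only [Pi.add_apply, hf, hg]; ring
    · simp only [Pi.add_apply, hf', hg']; ring
  zero_mem' := by simp
  smul_mem' := by
    rintro c f ⟨hf, hf'⟩
    refine ⟨fun a => ?_, fun a => ?_⟩
    · simp only [Pi.smul_apply, hf, smul_neg]
    · simp only [Pi.smul_apply, hf', smul_neg]

/-- Pulling the two strands apart at every crossing turns the projection into a disjoint union of
circles. The vertices of this graph are the pairs exchanged by `straightDart`. -/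
theorem linkSpace_eq_cycleSpace (k : Type*) [Field k] [Fintype D.darts] :
    D.linkSpace k = cycleSpace k D.revDart (Quot.mk fun a b => b = D.straightDart a) := by
  classical
  have hfib : ∀ (h : D.darts → k) a, ∑ b with Quot.mk (fun a b => b = D.straightDart a) b =
      Quot.mk (fun a b => b = D.straightDart a) a, h b = h a + h (D.straightDart a) := by
    intro h a
    have : ({b | Quot.mk (fun a b => b = D.straightDart a) b = Quot.mk _ a} : Finset D.darts) =
        {a, D.straightDart a} := by
      ext b
      rw [Finset.mem_filter]
      simp only [Finset.mem_univ, true_and, Finset.mem_insert, Finset.mem_singleton,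
        eq_comm (a := Quot.mk _ b), quot_involution_eq_iff _ D.straightDart_straightDart]
      rw [eq_comm]
    rw [this, Finset.sum_pair (D.straightDart_ne a).symm]
  ext h
  constructor
  · rintro ⟨h1, h2⟩
    refine ⟨h1, fun v => ?_⟩
    induction v using Quot.ind with | mk a =>
    convert hfib h a
    rw [h2, add_neg_cancel]
  · rintro ⟨h1, h2⟩
    refine ⟨h1, fun a => ?_⟩
    rw [eq_neg_iff_add_eq_zero, add_comm, ← hfib h a]
    convert h2 (Quot.mk _ a)

/-- In the graph of circles, edges and vertices each number half the darts, so E - V vanishes and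
only the number of components remains. -/
theorem finrank_linkSpace (k : Type*) [Field k] :
    Module.finrank k (D.linkSpace k) = Nat.card D.LinkComp := by
  have := Fintype.ofFinite D.darts
  have h1 := finrank_cycleSpace k D.revDart (Quot.mk fun a b => b = D.straightDart a)
    D.revDart_revDart D.revDart_ne Quot.mk_surjective
  rw [← D.linkSpace_eq_cycleSpace] at h1
  have h2 := two_mul_card_quot_involution D.revDart D.revDart_revDart D.revDart_ne
  have h3 := two_mul_card_quot_involution D.straightDart D.straightDart_straightDart
    D.straightDart_ne
  let r : D.darts → D.darts → Prop := fun a b => b = D.revDart a ∨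
    Quot.mk (fun a b => b = D.straightDart a) b = Quot.mk (fun a b => b = D.straightDart a) a
  let r' : D.darts → D.darts → Prop := fun a b => b.1 = D.rev a.1 ∨ b.1 = D.straight a.1
  have h4 : Nat.card (Quot r) = Nat.card D.LinkComp := by
    refine Nat.card_congr (β := Quot r')
      { toFun := Quot.lift (Quot.mk r') ?_
        invFun := Quot.lift (Quot.mk r) ?_
        left_inv := fun x => by induction x using Quot.ind with | mk a => rfl
        right_inv := fun x => by induction x using Quot.ind with | mk a => rfl }
    · rintro a b (h | h)
      · exact Quot.sound (Or.inl (congrArg Subtype.val h))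
      · rcases (quot_involution_eq_iff _ D.straightDart_straightDart _ _).1 h.symm with rfl | h
        · rfl
        · exact Quot.sound (Or.inr (congrArg Subtype.val h))
    · rintro a b (h | h)
      · exact Quot.sound (Or.inl (Subtype.ext h))
      · exact Quot.sound (Or.inr
          ((quot_involution_eq_iff _ D.straightDart_straightDart _ _).2 (Or.inr (Subtype.ext h))).symm)
  change _ = _ + Nat.card (Quot r) at h1
  omega

/-- At each vertex the two ends of a strand cancel, so a function constant along strands is a cycle
of the projection and therefore a jump. -/
theorem linkSpace_le_range (k : Type*) [Field k] :
    D.linkSpace k ≤ LinearMap.range (D.regionJump k) := by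
  classical
  have := Fintype.ofFinite D.darts
  rw [D.range_regionJump]
  rintro h ⟨h1, h2⟩
  refine ⟨h1, fun v => ?_⟩
  refine Finset.sum_involution (fun a _ => D.straightDart a) (fun a _ => by rw [h2]; ring)
    (fun a _ _ => D.straightDart_ne a) (fun a ha => ?_) (fun a _ => D.straightDart_straightDart a)
  simp only [Finset.mem_filter, Finset.mem_univ, true_and] at ha ⊢
  rw [← ha]
  exact Subtype.ext (D.vertex_straight a.2)

/-! ### Counting rules with weights -/

section Weights

variable (k : Type*) [Field k]

open Classical in
/-- The alternating sum over the four corners at the initial vertex of `a`, in which a region which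
touches twice is counted `2 - t` times. -/
noncomputable def cornerSum (t : k) (a : E) : (D.Region → k) →ₗ[k] k where
  toFun u := u (D.region a) - u (D.region (D.next a)) + u (D.region (D.next (D.next a))) -
      u (D.region (D.next (D.next (D.next a)))) -
    t * ((if D.region a = D.region (D.next (D.next a)) then u (D.region a) else 0) -
      if D.region (D.next a) = D.region (D.next (D.next (D.next a))) then u (D.region (D.next a))
      else 0)
  map_add' u v := by
    simp only [Pi.add_apply]; split_ifs <;> ring
  map_smul' c u := by
    simp only [Pi.smul_apply, smul_eq_mul, RingHom.id_apply]; split_ifs <;> ring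

/-- The functions on the regions whose weighted corner sums vanish. -/
noncomputable def cornerKer (t : D.Vertex → k) : Submodule k (D.Region → k) :=
  ⨅ (a : E) (_ : a ∈ D.darts ∧ D.degree D.darts (D.vertex a) = 4),
    LinearMap.ker (D.cornerSum k (t (D.vertex a)) a)

variable {k}

theorem mem_cornerKer {E : Type*} {D : LinkDiagram E} {t : D.Vertex → k} {u : D.Region → k} :
    u ∈ D.cornerKer k t ↔
    ∀ a ∈ D.darts, D.degree D.darts (D.vertex a) = 4 →
      D.cornerSum k (t (D.vertex a)) a u = 0 := by
  simp [cornerKer, Submodule.mem_iInf]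

/-- A quarter turn only changes the sign, so the vanishing of the sum depends on the crossing and
not on the starting dart. -/
theorem cornerSum_next (t : k) {a : E} (ha : a ∈ D.darts)
    (h : D.degree D.darts (D.vertex a) = 4) (u : D.Region → k) :
    D.cornerSum k t (D.next a) u = -D.cornerSum k t a u := by
  simp only [cornerSum, LinearMap.coe_mk, AddHom.coe_mk, D.next_four ha h]
  have hc : D.region (D.next (D.next a)) = D.region (D.next (D.next (D.next (D.next a)))) ↔
      D.region a = D.region (D.next (D.next a)) := by rw [D.next_four ha h, eq_comm]
  by_cases h1 : D.region a = D.region (D.next (D.next a))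
  · rw [if_pos (hc.2 h1), if_pos h1, h1]; ring
  · rw [if_neg (mt hc.1 h1), if_neg h1]; ring

/-- With weight 0 the corner sum is the jump across a dart plus the jump across the opposite one;
its vanishing says that the jump continues unchanged along the strand. At a vertex of degree 2 this
is automatic. -/
theorem cornerKer_zero : D.cornerKer k 0 = (D.linkSpace k).comap (D.regionJump k) := by
  ext u
  rw [mem_cornerKer, Submodule.mem_comap]
  have key : ∀ a ∈ D.darts, D.degree D.darts (D.vertex a) = 4 → D.cornerSum k 0 a u =
      (u (D.region a) - u (D.region (D.rev a))) +
      (u (D.region (D.straight a)) - u (D.region (D.rev (D.straight a)))) := by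
    intro a ha h
    rw [D.straight_of_four h, D.region_rev_next (D.next_mem ha), D.region_rev_eq ha h]
    simp only [cornerSum, LinearMap.coe_mk, AddHom.coe_mk]
    ring
  constructor
  · intro hu
    refine ⟨fun a => ?_, fun a => ?_⟩
    · simp [regionJump, revDart, D.rev_rev]
    · obtain ⟨a, ha⟩ := a
      simp only [regionJump, LinearMap.coe_mk, AddHom.coe_mk, straightDart]
      rw [eq_neg_iff_add_eq_zero, add_comm]
      by_cases h : D.degree D.darts (D.vertex a) = 4
      · rw [← key a ha h]
        exact hu a ha h
      · have h := D.degree_eq_two ha h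
        rw [D.straight_of_two h, D.region_rev_next ha, D.region_rev_eq_of_two ha h]
        ring
  · rintro ⟨-, h2⟩ a ha h
    have := h2 ⟨a, ha⟩
    rw [eq_neg_iff_add_eq_zero, add_comm] at this
    rw [Pi.zero_apply, key a ha h]
    exact this

/-- The kernel for the double counting rule. -/
theorem finrank_cornerKer_zero :
    Module.finrank k (D.cornerKer k 0) = Nat.card D.LinkComp + 1 := by
  rw [D.cornerKer_zero, finrank_comap_of_le_range _ _ (D.linkSpace_le_range k),
    D.finrank_linkSpace, D.finrank_ker_regionJump]

/-- The values on the two sides of an edge can be prescribed in a submodule. -/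
def SeparatesSides (K : Submodule k (D.Region → k)) : Prop :=
  ∀ a ∈ D.darts, ∀ p q : k, ∃ u ∈ K, u (D.region a) = p ∧ u (D.region (D.rev a)) = q

/-- Orienting the link component through the edge gives a solution whose jump there is 1. Scaling it
and adding a constant attains any two values. -/
theorem separatesSides_cornerKer_zero : D.SeparatesSides (D.cornerKer k 0) := by
  intro a ha p q
  obtain ⟨h, h1, h2, h3⟩ := exists_common_orientation k D.revDart D.straightDart D.revDart_revDart
    D.straightDart_straightDart D.revDart_ne D.straightDart_ne ⟨a, ha⟩
  have hmem : h ∈ D.linkSpace k := ⟨h1, h2⟩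
  obtain ⟨u, rfl⟩ := D.linkSpace_le_range k hmem
  rw [D.cornerKer_zero]
  refine ⟨(p - q) • u + fun _ => q - (p - q) * u (D.region (D.rev a)), ?_, ?_, ?_⟩
  · rw [Submodule.mem_comap, map_add, map_smul]
    convert (D.linkSpace k).smul_mem (p - q) hmem
    convert add_zero _
    ext b
    simp [regionJump]
  · simp only [regionJump, LinearMap.coe_mk, AddHom.coe_mk] at h3
    simp only [Pi.add_apply, Pi.smul_apply, smul_eq_mul]
    linear_combination (p - q) * h3
  · simp

end Weights

end LinkDiagram

/-! ### Closed curves through a crossing that a region touches twice -/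

namespace LinkDiagram

variable {E : Type*} (D : LinkDiagram E) [Finite E]

/-- Adjacent corners have opposite checkerboard colours. -/
theorem region_next_ne {a : E} (ha : a ∈ D.darts) : D.region (D.next a) ≠ D.region a := by
  obtain ⟨ε, h1, h2⟩ := D.exists_checkerboard
  intro h
  have h3 := h2 _ (D.next_mem ha)
  rw [D.region_rev_next ha, h] at h3
  have h4 := h1 (D.region a)
  have : ε (D.region a) = 0 := by omega
  rw [this] at h4
  omega

/-- The darts which a small arc about a crossing meets when it leads from one corner to the
opposite one. -/
theorem exists_fan {a : E} (ha : a ∈ D.darts) (h : D.degree D.darts (D.vertex a) = 4) :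
    ∃ k : ℕ, (D.rot ^ k) a = D.next (D.next a) ∧
      (∀ i j, 1 ≤ i → i ≤ k → 1 ≤ j → j ≤ k → (D.rot ^ i) a = (D.rot ^ j) a → i = j) ∧
      (∃ i, 1 ≤ i ∧ i ≤ k ∧ (D.rot ^ i) a = D.next a) ∧
      ∀ i, 1 ≤ i → i ≤ k → (D.rot ^ i) a ≠ D.next (D.next (D.next a)) := by
  obtain ⟨k₁, h1, h2, h3, h4⟩ := D.turn_spec D.darts ha
  obtain ⟨k₂, g1, g2, g3, g4⟩ := D.turn_spec D.darts (D.next_mem ha)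
  change D.next a = _ at h2
  change D.next (D.next a) = _ at g2
  have hadd : ∀ i, (D.rot ^ (k₁ + i)) a = (D.rot ^ i) (D.next a) := by
    intro i
    rw [h2, add_comm, pow_add, Equiv.Perm.mul_apply]
  have hd : ∀ i, 1 ≤ i → i ≤ k₁ + k₂ → (D.rot ^ i) a ∈ D.darts →
      (D.rot ^ i) a = D.next a ∨ (D.rot ^ i) a = D.next (D.next a) := by
    intro i hi hi' hm
    rcases lt_trichotomy i k₁ with hlt | rfl | hgt
    · exact absurd hm (h4 i hi hlt)
    · exact Or.inl h2.symm
    · obtain ⟨j, rfl⟩ := Nat.exists_eq_add_of_lt hgt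
      rw [add_assoc, hadd] at hm ⊢
      rcases Nat.lt_or_ge (j + 1) k₂ with hlt | hge
      · exact absurd hm (g4 _ (by omega) hlt)
      · have : j + 1 = k₂ := by omega
        rw [this, ← g2]; exact Or.inr rfl
  have hna : ∀ i, 1 ≤ i → i ≤ k₁ + k₂ → (D.rot ^ i) a ≠ a := by
    intro i hi hi' he
    rcases hd i hi hi' (by rwa [he]) with h' | h' <;> rw [he] at h'
    · exact D.next_iterate_ne ha h (i := 0) (j := 1) (by omega) (by omega) (by omega) h'
    · exact D.next_iterate_ne ha h (i := 0) (j := 2) (by omega) (by omega) (by omega) h'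
  have hinj : ∀ i j, 1 ≤ i → i < j → j ≤ k₁ + k₂ → (D.rot ^ i) a ≠ (D.rot ^ j) a := by
    intro i j hi hij hj he
    apply hna (j - i) (by omega) (by omega)
    apply (D.rot ^ i).injective
    rw [← Equiv.Perm.mul_apply, ← pow_add, he]
    congr 2
    omega
  refine ⟨k₁ + k₂, by rw [hadd, g2], ?_, ⟨k₁, h1, by omega, h2.symm⟩, ?_⟩
  · intro i j hi hi' hj hj' he
    rcases lt_trichotomy i j with hlt | rfl | hgt
    · exact absurd he (hinj i j hi hlt hj')
    · rfl
    · exact absurd he.symm (hinj j i hj hgt hi')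
  · intro i hi hi' he
    rcases hd i hi hi' (by rw [he]; exact D.next_mem (D.next_mem (D.next_mem ha))) with h' | h' <;>
      rw [he] at h'
    · exact D.next_iterate_ne ha h (i := 3) (j := 1) (by omega) (by omega) (by omega) h'
    · exact D.next_iterate_ne ha h (i := 3) (j := 2) (by omega) (by omega) (by omega) h'

/-- If a region touches a crossing at opposite corners, a closed curve in this region which passes
through the crossing separates the rest of the diagram. -/
theorem exists_separation {a : E} (ha : a ∈ D.darts) (h : D.degree D.darts (D.vertex a) = 4)
    (hR : D.region a = D.region (D.next (D.next a))) :
    ∃ (F : Set D.Region) (s : E → Prop), D.region a ∉ F ∧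
      (∀ b, D.region b ≠ D.region a → (D.region b ∈ F ↔ s b)) ∧
      (∀ b ∈ D.darts, s (D.rev b) ↔ s b) ∧
      (∀ b c, D.vertex b = D.vertex c → D.vertex b ≠ D.vertex a → (s b ↔ s c)) ∧
      s (D.next a) ∧ ¬ s (D.next (D.next (D.next a))) := by
  classical
  have := Fintype.ofFinite E
  obtain ⟨k, hk, hinj, hmem, hnot⟩ := D.exists_fan ha h
  -- The cell structure with the edges interior to the doubled region removed, so that the region
  -- becomes a single face. The function `c` marks the darts crossed by the small arc between its
  -- two corners.
  let P : Set E := {b | b ∈ D.darts ∨ D.region b ≠ D.region a}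
  have hP : ∀ b ∈ P, D.rev b ∈ P := by
    intro b hb
    by_cases hbd : b ∈ D.darts
    · exact Or.inl (D.rev_mem b hbd)
    · rcases hb with hb | hb
      · exact absurd hb hbd
      · exact Or.inr (by rwa [D.region_rev hbd])
  let c : E → ℚ := fun b => if ∃ i, 1 ≤ i ∧ i ≤ k ∧ (D.rot ^ i) a = b then 1 else 0
  have hc0 : ∀ b, D.vertex b ≠ D.vertex a → c b = 0 := by
    intro b hb
    refine if_neg ?_
    rintro ⟨i, -, -, rfl⟩
    exact hb (D.vertex_rot_pow i a)
  -- The arc begins and ends in the region of `a`, so membership in it cannot change at a corner of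
  -- any other region.
  have hcrot : ∀ b, D.region b ≠ D.region a → c (D.rot b) = c b := by
    intro b hb
    simp only [c]
    congr 1
    rw [eq_iff_iff]
    constructor
    · rintro ⟨i, hi, hi', he⟩
      obtain ⟨j, rfl⟩ := Nat.exists_eq_add_of_le' hi
      rw [pow_succ', Equiv.Perm.mul_apply, EmbeddingLike.apply_eq_iff_eq] at he
      refine ⟨j, ?_, by omega, he⟩
      rcases Nat.eq_zero_or_pos j with rfl | hj
      · exact absurd (congrArg D.region he.symm) hb
      · exact hj
    · rintro ⟨i, hi, hi', rfl⟩
      refine ⟨i + 1, by omega, ?_, by rw [pow_succ', Equiv.Perm.mul_apply]⟩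
      rcases Nat.lt_or_ge i k with hlt | hge
      · exact hlt
      · obtain rfl : i = k := by omega
        rw [hk] at hb
        exact absurd hR.symm hb
  -- A cycle on `P` is the jump of a potential `f` constant on the faces of the doubled region.
  -- Summed along the arc, the jumps telescope to the difference of `f` at the two ends, which is
  -- zero.
  have hvan : ∀ w ∈ cycleSpace ℚ (fun b : P => (⟨D.rev b, hP b b.2⟩ : P)) (fun b : P => D.vertex b.1),
      ∑ b : P, c b * w b = 0 := by
    rintro w ⟨h1, h2⟩
    obtain ⟨f, hf, hf'⟩ := D.exists_potential ℚ P hP w (fun b hb => h1 ⟨b, hb⟩)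
      (fun v => by convert h2 v)
    obtain ⟨u, hu⟩ := D.exists_region_eq
      (fun b => if D.region b = D.region a then f (D.face b) else 0)
      (fun b => by rw [D.region_next, D.face_next])
      (fun b hb => by
        rw [D.region_rev hb]
        split_ifs with hbR
        · exact (hf' b (fun hbP => hbP.elim hb fun h' => h' hbR)).symm
        · rfl)
    have hends : f (D.face a) = f (D.face ((D.rot ^ k) a)) := by
      have e1 := hu a
      have e2 := hu (D.next (D.next a))
      rw [if_pos rfl] at e1
      rw [if_pos hR.symm, ← hR, e1] at e2
      rw [hk, e2]
    have e1 : ∑ b : P, c b * w b = ∑ b : E, c b * (f (D.face b) - f (D.face (D.rev b))) := by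
      refine Finset.sum_bij_ne_zero (fun b _ _ => b.1) (fun _ _ _ => Finset.mem_univ _)
        (fun _ _ _ _ _ _ hab => Subtype.ext hab) (fun b _ hb => ?_) (fun b _ _ => by rw [hf b])
      by_cases hbP : b ∈ P
      · exact ⟨⟨b, hbP⟩, Finset.mem_univ _, by rw [← hf ⟨b, hbP⟩]; exact hb, rfl⟩
      · rw [hf' b hbP, sub_self, mul_zero] at hb
        exact absurd rfl hb
    have e2 : ∑ b : E, c b * (f (D.face b) - f (D.face (D.rev b))) =
        ∑ i ∈ Finset.Ico 1 (k + 1),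
          (f (D.face ((D.rot ^ i) a)) - f (D.face (D.rev ((D.rot ^ i) a)))) := by
      rw [← Finset.sum_image (s := Finset.Ico 1 (k + 1)) (g := fun i => (D.rot ^ i) a)
        (f := fun b => f (D.face b) - f (D.face (D.rev b)))]
      · rw [← Finset.sum_filter_add_sum_filter_not Finset.univ
          (fun b => ∃ i, 1 ≤ i ∧ i ≤ k ∧ (D.rot ^ i) a = b)]
        rw [Finset.sum_eq_zero (s := Finset.filter (fun b => ¬ _) _), add_zero]
        · refine Finset.sum_congr ?_ fun b hb => ?_
          · ext b
            simp [and_assoc]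
          · simp only [Finset.mem_image, Finset.mem_Ico] at hb
            obtain ⟨i, hi, rfl⟩ := hb
            simp only [c]
            rw [if_pos ⟨i, hi.1, by omega, rfl⟩, one_mul]
        · intro b hb
          simp only [c]
          rw [if_neg (Finset.mem_filter.1 hb).2, zero_mul]
      · intro i hi j hj he
        simp only [Finset.coe_Ico, Set.mem_Ico] at hi hj
        exact hinj i j hi.1 (by omega) hj.1 (by omega) he
    rw [e1, e2, Finset.sum_Ico_eq_sum_range, Nat.add_sub_cancel,
      Finset.sum_congr rfl (g := fun i => f (D.face ((D.rot ^ (i + 1)) a)) -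
        f (D.face ((D.rot ^ i) a))), Finset.sum_range_sub (fun i => f (D.face ((D.rot ^ i) a))),
      ← hends, pow_zero, Equiv.Perm.one_apply, sub_self]
    intro i _
    rw [add_comm 1 i, pow_succ', Equiv.Perm.mul_apply, D.face_rev_rot]
  obtain ⟨g, hg⟩ := exists_coboundary_of_vanish ℚ _ _ (fun b => Subtype.ext (D.rev_rev b.1))
    (fun b : P => c b) hvan
  -- Being a coboundary, `c` can be corrected by its potential to be invariant under `rev`. The
  -- normalization at the crossing gives 1 on the arc's side and 0 on the other; away from the
  -- crossing `c` is 0, so `s` depends only on the vertex.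
  let s : E → ℚ := fun b => c b - g (D.vertex b) + g (D.vertex a)
  have hsrev : ∀ b ∈ P, s (D.rev b) = s b := by
    intro b hb
    have := hg ⟨b, hb⟩
    dsimp only at this
    simp only [s]
    linear_combination -this
  have hsrot : ∀ b, D.region b ≠ D.region a → s (D.rot b) = s b := by
    intro b hb
    simp only [s]
    rw [hcrot b hb, D.vertex_rot]
  obtain ⟨F, hF⟩ := D.exists_region_eq (fun b => D.region b ≠ D.region a ∧ s b = 1)
    (fun b => by
      rw [D.region_next, eq_iff_iff]
      refine and_congr_right fun hb => ?_
      rw [← hsrev b (Or.inr hb), ← hsrot (D.rot⁻¹ (D.rev b)) (by rwa [D.region_next])]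
      simp)
    (fun b hb => by
      rw [D.region_rev hb, eq_iff_iff]
      refine and_congr_right fun hb' => ?_
      rw [hsrev b (Or.inr hb')])
  have hF' : ∀ b, F (D.region b) ↔ D.region b ≠ D.region a ∧ s b = 1 := fun b => by rw [hF]
  refine ⟨{R | F R}, fun b => s b = 1, ?_, ?_, ?_, ?_, ?_, ?_⟩
  · intro h'
    exact ((hF' a).1 h').1 rfl
  · intro b hb
    exact (hF' b).trans (and_iff_right hb)
  · intro b hb
    dsimp only
    rw [hsrev b (Or.inl hb)]
  · intro b b' hbb hb
    simp only [s]
    rw [hc0 b hb, hc0 b' (hbb ▸ hb), hbb]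
  · simp only [s, c]
    rw [if_pos hmem, D.vertex_next ha]
    ring
  · simp only [s, c]
    rw [if_neg (by rintro ⟨i, hi, hi', he⟩; exact hnot i hi hi' he),
      D.vertex_next (D.next_mem (D.next_mem ha)), D.vertex_next (D.next_mem ha), D.vertex_next ha]
    norm_num

end LinkDiagram

/-! ### Independence of the kernel dimension from the weights -/

namespace LinkDiagram

variable {E : Type*} (D : LinkDiagram E) [Finite E]

/-- A region which touches a crossing at two opposite corners separates the other two corners. -/
theorem region_next_ne_of_opposite {a : E} (ha : a ∈ D.darts)
    (h : D.degree D.darts (D.vertex a) = 4) (hR : D.region a = D.region (D.next (D.next a))) :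
    D.region (D.next a) ≠ D.region (D.next (D.next (D.next a))) := by
  obtain ⟨F, s, -, hF, -, -, h1, h3⟩ := D.exists_separation ha h hR
  have hne := D.region_next_ne (D.next_mem (D.next_mem (D.next_mem ha)))
  rw [D.next_four ha h] at hne
  intro he
  exact h3 ((hF _ hne.symm).1 (he ▸ (hF _ (D.region_next_ne ha)).2 h1))

variable {k : Type*} [Field k]

theorem cornerSum_congr {E : Type*} (D : LinkDiagram E) (t : k) (a : E) {u u' : D.Region → k}
    (h0 : u (D.region a) = u' (D.region a)) (h1 : u (D.region (D.next a)) = u' (D.region (D.next a)))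
    (h2 : u (D.region (D.next (D.next a))) = u' (D.region (D.next (D.next a))))
    (h3 : u (D.region (D.next (D.next (D.next a)))) = u' (D.region (D.next (D.next (D.next a))))) :
    D.cornerSum k t a u = D.cornerSum k t a u' := by
  simp only [cornerSum, LinearMap.coe_mk, AddHom.coe_mk, h0, h1, h2, h3]

theorem cornerSum_of_opposite (t : k) {a : E} (ha : a ∈ D.darts)
    (h : D.degree D.darts (D.vertex a) = 4) (hR : D.region a = D.region (D.next (D.next a)))
    (u : D.Region → k) :
    D.cornerSum k t a u = u (D.region a) - u (D.region (D.next a)) + u (D.region a) -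
      u (D.region (D.next (D.next (D.next a)))) - t * u (D.region a) := by
  simp only [cornerSum, LinearMap.coe_mk, AddHom.coe_mk]
  rw [if_pos hR, if_neg (D.region_next_ne_of_opposite ha h hR), ← hR, sub_zero]

theorem cornerSum_eq_zero_of_vertex_eq {t : k} {a b : E} (ha : a ∈ D.darts)
    (h : D.degree D.darts (D.vertex a) = 4) (hb : b ∈ D.darts) (hv : D.vertex b = D.vertex a)
    {u : D.Region → k} (hu : D.cornerSum k t a u = 0) : D.cornerSum k t b u = 0 := by
  have h1 := D.vertex_next ha
  have h2 := (D.vertex_next (D.next_mem ha)).trans h1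
  rcases D.eq_next_of_vertex_eq ha h hb hv with rfl | rfl | rfl | rfl
  · exact hu
  · rw [D.cornerSum_next t ha h, hu, neg_zero]
  · rw [D.cornerSum_next t (D.next_mem ha) (h1 ▸ h), D.cornerSum_next t ha h, hu, neg_zero, neg_zero]
  · rw [D.cornerSum_next t (D.next_mem (D.next_mem ha)) (h2 ▸ h),
      D.cornerSum_next t (D.next_mem ha) (h1 ▸ h), D.cornerSum_next t ha h, hu]
    simp

/-- The correction which changes the weight of a crossing. -/
theorem sub_smul_mem_cornerKer {t t' : D.Vertex → k} {a : E} (ha : a ∈ D.darts)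
    (h : D.degree D.darts (D.vertex a) = 4) (hR : D.region a = D.region (D.next (D.next a)))
    (htt : ∀ v, v ≠ D.vertex a → t v = t' v) {w : D.Region → k}
    (hw : ∀ b ∈ D.darts, D.degree D.darts (D.vertex b) = 4 → D.vertex b ≠ D.vertex a →
      D.cornerSum k (t (D.vertex b)) b w = 0)
    (hw0 : w (D.region a) = 0)
    (hw1 : w (D.region (D.next a)) + w (D.region (D.next (D.next (D.next a)))) = 1)
    {u : D.Region → k} (hu : u ∈ D.cornerKer k t) :
    u - ((t' (D.vertex a) - t (D.vertex a)) * u (D.region a)) • w ∈ D.cornerKer k t' := by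
  rw [mem_cornerKer] at hu ⊢
  intro b hb hb4
  by_cases hv : D.vertex b = D.vertex a
  · rw [hv]
    refine D.cornerSum_eq_zero_of_vertex_eq ha h hb hv ?_
    have h1 := hu a ha h
    rw [D.cornerSum_of_opposite _ ha h hR] at h1
    rw [map_sub, map_smul, D.cornerSum_of_opposite _ ha h hR, D.cornerSum_of_opposite _ ha h hR,
      hw0, smul_eq_mul]
    linear_combination h1 + (t' (D.vertex a) - t (D.vertex a)) * u (D.region a) * hw1
  · rw [map_sub, map_smul, ← htt _ hv, hu b hb hb4, hw b hb hb4 hv, smul_zero, sub_zero]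

/-- The separation property accompanies the dimension because the next change of weight needs it to
produce the solution that is cut off. -/
theorem cornerKer_change_weight {t t' : D.Vertex → k} {v : D.Vertex}
    (htt : ∀ w, w ≠ v → t w = t' w) (hsep : D.SeparatesSides (D.cornerKer k t)) :
    Module.finrank k (D.cornerKer k t') = Module.finrank k (D.cornerKer k t) ∧
      D.SeparatesSides (D.cornerKer k t') := by
  classical
  by_cases hred : ∃ a ∈ D.darts, D.vertex a = v ∧ D.degree D.darts (D.vertex a) = 4 ∧
      D.region a = D.region (D.next (D.next a))
  · obtain ⟨a, ha, rfl, h, hR⟩ := hred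
    obtain ⟨F, s, hRF, hF, hrev, hvert, hs1, hs3⟩ := D.exists_separation ha h hR
    obtain ⟨v₀, hv₀, hv1, hv0⟩ := hsep _ (D.next_mem ha) 1 0
    rw [D.region_rev_next ha] at hv0
    let w : D.Region → k := fun R => if R ∈ F then v₀ R else 0
    -- The curve runs inside the region of `a`, where `s` may take both truth values; the formula
    -- still holds there because `v₀` vanishes.
    have hws : ∀ b, w (D.region b) = if s b then v₀ (D.region b) else 0 := by
      intro b
      by_cases hb : D.region b = D.region a
      · simp [w, hb, hRF, hv0]
      · simp only [w, hF b hb]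
    have hw0 : w (D.region a) = 0 := if_neg hRF
    have hw1 : w (D.region (D.next a)) = 1 := by rw [hws, if_pos hs1, hv1]
    have hw3 : w (D.region (D.next (D.next (D.next a)))) = 0 := by rw [hws, if_neg hs3]
    have hv3 : v₀ (D.region (D.next (D.next (D.next a)))) = -1 := by
      have := mem_cornerKer.1 hv₀ a ha h
      rw [D.cornerSum_of_opposite _ ha h hR, hv0, hv1] at this
      linear_combination -this
    have hw : ∀ b ∈ D.darts, D.degree D.darts (D.vertex b) = 4 → D.vertex b ≠ D.vertex a →
        D.cornerSum k (t (D.vertex b)) b w = 0 := by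
      intro b hb hb4 hbv
      have n1 := D.vertex_next hb
      have n2 := (D.vertex_next (D.next_mem hb)).trans n1
      have n3 := (D.vertex_next (D.next_mem (D.next_mem hb))).trans n2
      have s1 := hvert b _ n1.symm hbv
      have s2 := hvert b _ n2.symm hbv
      have s3 := hvert b _ n3.symm hbv
      by_cases hsb : s b
      · rw [← mem_cornerKer.1 hv₀ b hb hb4]
        apply D.cornerSum_congr
        · rw [hws, if_pos hsb]
        · rw [hws, if_pos (s1.1 hsb)]
        · rw [hws, if_pos (s2.1 hsb)]
        · rw [hws, if_pos (s3.1 hsb)]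
      · rw [← map_zero (D.cornerSum k (t (D.vertex b)) b)]
        apply D.cornerSum_congr
        · rw [hws, if_neg hsb]; rfl
        · rw [hws, if_neg (mt s1.2 hsb)]; rfl
        · rw [hws, if_neg (mt s2.2 hsb)]; rfl
        · rw [hws, if_neg (mt s3.2 hsb)]; rfl
    have hwsum : w (D.region (D.next a)) + w (D.region (D.next (D.next (D.next a)))) = 1 := by
      rw [hw1, hw3, add_zero]
    have hw' : ∀ b ∈ D.darts, D.degree D.darts (D.vertex b) = 4 → D.vertex b ≠ D.vertex a →
        D.cornerSum k (t' (D.vertex b)) b w = 0 := by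
      intro b hb hb4 hbv
      rw [← htt _ hbv]
      exact hw b hb hb4 hbv
    constructor
    · let δ := t' (D.vertex a) - t (D.vertex a)
      let e : D.cornerKer k t ≃ₗ[k] D.cornerKer k t' :=
        { toFun := fun u => ⟨u.1 - (δ * u.1 (D.region a)) • w,
            D.sub_smul_mem_cornerKer ha h hR htt hw hw0 hwsum u.2⟩
          map_add' := by
            intro x y
            ext R
            simp; ring
          map_smul' := by
            intro c x
            ext R
            simp; ring
          -- The inverse exchanges the two weights: since `w` vanishes on the region of `a`, the
          -- correction preserves the value of `u` there.
          invFun := fun u => ⟨u.1 - ((t (D.vertex a) - t' (D.vertex a)) * u.1 (D.region a)) • w,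
            D.sub_smul_mem_cornerKer ha h hR (fun v hv => (htt v hv).symm) hw' hw0 hwsum u.2⟩
          left_inv := by
            intro u
            ext R
            simp [hw0, δ]; ring
          right_inv := by
            intro u
            ext R
            simp [hw0, δ]; ring }
      exact e.finrank_eq.symm
    · intro b hb p q
      obtain ⟨u, hu, hp, hq⟩ := hsep b hb p q
      by_cases hsb : s b
      -- Of the two admissible corrections, `w` vanishes on one side of the curve and `w - v₀` on
      -- the other. The one that leaves the values beside `b` unchanged is chosen; its corner values
      -- still add to 1, as `v₀` takes the values 1 and -1.
      · refine ⟨_, D.sub_smul_mem_cornerKer (w := w - v₀) ha h hR htt ?_ ?_ ?_ hu, ?_, ?_⟩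
        · intro b hb hb4 hbv
          rw [map_sub, hw b hb hb4 hbv, mem_cornerKer.1 hv₀ b hb hb4, sub_zero]
        · simp [hw0, hv0]
        · simp [hw1, hw3, hv1, hv3]
        · simp [hws, hsb, hp]
        · simp [hws, (hrev b hb).2 hsb, hq]
      · refine ⟨_, D.sub_smul_mem_cornerKer ha h hR htt hw hw0 hwsum hu, ?_, ?_⟩
        · simp [hws, hsb, hp]
        · simp [hws, mt (hrev b hb).1 hsb, hq]
  · have : D.cornerKer k t' = D.cornerKer k t := by
      ext u
      rw [mem_cornerKer, mem_cornerKer]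
      refine forall_congr' fun a => forall_congr' fun ha => forall_congr' fun h => ?_
      by_cases hv : D.vertex a = v
      · have h1 : D.region a ≠ D.region (D.next (D.next a)) := fun hR => hred ⟨a, ha, hv, h, hR⟩
        have h2 : D.region (D.next a) ≠ D.region (D.next (D.next (D.next a))) := fun hR =>
          hred ⟨_, D.next_mem ha, (D.vertex_next ha).trans hv, (D.vertex_next ha).symm ▸ h, hR⟩
        simp only [cornerSum, LinearMap.coe_mk, AddHom.coe_mk]
        rw [if_neg h1, if_neg h2]
        simp
      · rw [htt _ hv]
    rw [this]
    exact ⟨rfl, hsep⟩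

/-- The dimension of the kernel does not depend on the weights. -/
theorem finrank_cornerKer (t : D.Vertex → k) :
    Module.finrank k (D.cornerKer k t) = Nat.card D.LinkComp + 1 := by
  classical
  have := Fintype.ofFinite D.Vertex
  -- The weights are switched on one vertex at a time, starting from double counting.
  suffices H : ∀ T : Finset D.Vertex,
      Module.finrank k (D.cornerKer k fun v => if v ∈ T then t v else 0) = Nat.card D.LinkComp + 1 ∧
      D.SeparatesSides (D.cornerKer k fun v => if v ∈ T then t v else 0) by
    have e : t = fun v => if v ∈ Finset.univ then t v else 0 :=
      funext fun v => (if_pos (Finset.mem_univ v)).symm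
    rw [e]
    exact (H Finset.univ).1
  intro T
  induction T using Finset.induction_on with
  | empty => exact ⟨D.finrank_cornerKer_zero, D.separatesSides_cornerKer_zero⟩
  | insert v T hv ih =>
    rw [← ih.1]
    refine D.cornerKer_change_weight (v := v) (fun w hw => ?_) ih.2
    simp [hw]

end LinkDiagram

/-! ### Passage from integers to rationals -/

/-- The rank of the integral kernel of an integer matrix is the dimension of its rational kernel. -/
theorem finrank_int_ker_eq {m n : Type*} [Fintype n] (A : Matrix m n ℤ) :
    Module.finrank ℤ (LinearMap.ker A.mulVecLin) =
      Module.finrank ℚ (LinearMap.ker (A.map (Int.cast : ℤ → ℚ)).mulVecLin) := by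
  have hcast : ∀ u : n → ℤ, (A.map (Int.cast : ℤ → ℚ)).mulVec (fun j => (u j : ℚ)) =
      fun i => ((A.mulVec u i : ℤ) : ℚ) := by
    intro u
    ext i
    simp [Matrix.mulVec, dotProduct]
  let f : LinearMap.ker A.mulVecLin →ₗ[ℤ] LinearMap.ker (A.map (Int.cast : ℤ → ℚ)).mulVecLin :=
    { toFun := fun u => ⟨fun j => (u.1 j : ℚ), by
        rw [LinearMap.mem_ker, Matrix.mulVecLin_apply, hcast]
        have := u.2
        rw [LinearMap.mem_ker, Matrix.mulVecLin_apply] at this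
        rw [this]
        ext i
        simp⟩
      map_add' := by
        intro x y
        ext j
        simp
      map_smul' := by
        intro c x
        ext j
        simp }
  -- The rational kernel is the localization of the integral one: nonzero integers act invertibly,
  -- denominators of a solution can be cleared, and the inclusion is injective.
  have hloc : IsLocalizedModule (nonZeroDivisors ℤ) f := by
    refine ⟨?_, ?_, ?_⟩
    · intro c
      rw [Module.End.isUnit_iff]
      have hc : (c.1 : ℚ) ≠ 0 := Int.cast_ne_zero.2 (nonZeroDivisors.ne_zero c.2)
      constructor
      · intro x y hxy
        ext j
        have := congrFun (congrArg Subtype.val hxy) j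
        simpa [hc] using this
      · intro y
        refine ⟨(c.1 : ℚ)⁻¹ • y, ?_⟩
        ext j
        simp [hc]
    · intro y
      obtain ⟨b, hb⟩ := IsLocalization.exist_integer_multiples_of_finite (nonZeroDivisors ℤ) y.1
      choose u hu using hb
      have hu' : (fun j => (u j : ℚ)) = (b.1 : ℚ) • y.1 := by
        ext j
        have := hu j
        simpa using this
      refine ⟨(⟨u, ?_⟩, b), ?_⟩
      · rw [LinearMap.mem_ker, Matrix.mulVecLin_apply]
        have h1 := hcast u
        have h2 := y.2
        rw [LinearMap.mem_ker, Matrix.mulVecLin_apply] at h2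
        rw [hu', Matrix.mulVec_smul, h2, smul_zero] at h1
        ext i
        have := congrFun h1 i
        simpa using this.symm
      · ext j
        have := congrFun hu' j
        simpa [f, Submonoid.smul_def] using this.symm
    · intro x y hxy
      refine ⟨1, ?_⟩
      rw [one_smul, one_smul]
      ext j
      have := congrFun (congrArg Subtype.val hxy) j
      simpa [f] using this
  have := hloc
  rw [IsLocalization.finrank_eq ℚ (nonZeroDivisors ℤ) le_rfl]
  exact (IsLocalizedModule.finrank_eq (nonZeroDivisors ℤ) f le_rfl).symm

/-! ### The two region choice matrices -/

namespace LinkDiagram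

variable {E : Type*} (D : LinkDiagram E) [Finite E]

theorem exists_dart_at {E : Type*} (D : LinkDiagram E) (x : D.Crossing) :
    ∃ a ∈ D.darts, D.vertex a = x.1 := by
  have h : Nat.card {a : E // a ∈ D.darts ∧ D.vertex a = x.1} = 4 := x.2
  have : Nonempty {a : E // a ∈ D.darts ∧ D.vertex a = x.1} := by
    by_contra hne
    rw [not_nonempty_iff] at hne
    rw [Nat.card_of_isEmpty] at h
    omega
  obtain ⟨a, ha, hv⟩ := this
  exact ⟨a, ha, hv⟩

theorem onBoundary_iff {x : D.Crossing} {a : E} (ha : a ∈ D.darts) (hx : D.vertex a = x.1)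
    (R : D.Region) : D.OnBoundary x R ↔ R = D.region a ∨ R = D.region (D.next a) ∨
      R = D.region (D.next (D.next a)) ∨ R = D.region (D.next (D.next (D.next a))) := by
  have h : D.degree D.darts (D.vertex a) = 4 := hx ▸ x.2
  have n1 := D.vertex_next ha
  have n2 := (D.vertex_next (D.next_mem ha)).trans n1
  have n3 := (D.vertex_next (D.next_mem (D.next_mem ha))).trans n2
  constructor
  · rintro ⟨b, hb, rfl⟩
    obtain ⟨b', hb', hv, hR⟩ := D.exists_dart_region (a := b) ⟨a, ha, hx.trans hb.symm⟩
    rw [← hR]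
    rcases D.eq_next_of_vertex_eq ha h hb' (hv.trans (hb.trans hx.symm)) with e | e | e | e <;>
      simp [e]
  · rintro (rfl | rfl | rfl | rfl)
    · exact ⟨_, hx, rfl⟩
    · exact ⟨_, n1.trans hx, rfl⟩
    · exact ⟨_, n2.trans hx, rfl⟩
    · exact ⟨_, n3.trans hx, rfl⟩

open Classical in
/-- The sum over the regions at a crossing, counted once, in terms of the signs of a checkerboard
colouring. -/
theorem sum_onBoundary {x : D.Crossing} {a : E} (ha : a ∈ D.darts) (hx : D.vertex a = x.1)
    {ε : D.Region → ℚ} (h1 : ∀ R, ε R * ε R = 1)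
    (h2 : ∀ a ∈ D.darts, ε (D.region (D.rev a)) = -ε (D.region a)) (u : D.Region → ℚ) :
    ∑ R, (if D.OnBoundary x R then u R else 0) =
      ε (D.region a) * D.cornerSum ℚ 1 a (fun R => ε R * u R) := by
  have h : D.degree D.darts (D.vertex a) = 4 := hx ▸ x.2
  have hnext : ∀ b ∈ D.darts, ε (D.region (D.next b)) = -ε (D.region b) := fun b hb => by
    rw [← D.region_rev_next hb, h2 _ (D.next_mem hb), neg_neg]
  have m1 := D.next_mem ha
  have m2 := D.next_mem m1
  have m3 := D.next_mem m2
  have e1 := hnext _ ha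
  have e2 := hnext _ m1
  have e3 := hnext _ m2
  have d1 := D.region_next_ne ha
  have d2 := D.region_next_ne m1
  have d3 := D.region_next_ne m2
  have d4 := D.region_next_ne m3
  rw [D.next_four ha h] at d4
  have h0 := h1 (D.region a)
  rw [← Finset.sum_filter]
  have hset : (Finset.univ.filter fun R => D.OnBoundary x R) = {D.region a, D.region (D.next a),
      D.region (D.next (D.next a)), D.region (D.next (D.next (D.next a)))} := by
    ext R
    simp [D.onBoundary_iff ha hx]
  have hd := D.region_next_ne_of_opposite ha h
  rw [hset]
  simp only [cornerSum, LinearMap.coe_mk, AddHom.coe_mk]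
  generalize D.region a = R0 at *
  generalize D.region (D.next a) = R1 at *
  generalize D.region (D.next (D.next a)) = R2 at *
  generalize D.region (D.next (D.next (D.next a))) = R3 at *
  -- Adjacent corners lie in different regions and at most one opposite pair coincides, so the set
  -- of corner regions has three or four elements; the weight 1 removes the repetition from the
  -- corner sum.
  by_cases h02 : R0 = R2
  · subst h02
    have h13 := hd rfl
    have hs : ({R0, R1, R0, R3} : Finset D.Region) = {R0, R1, R3} := by
      ext R
      simp only [Finset.mem_insert, Finset.mem_singleton]
      tauto
    rw [if_pos rfl, if_neg h13, hs, Finset.sum_insert (by simp [d4, d1.symm]), Finset.sum_pair h13,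
      e1, e3]
    linear_combination (-u R0 - u R1 - u R3) * h0
  · by_cases h13 : R1 = R3
    · subst h13
      have hs : ({R0, R1, R2, R1} : Finset D.Region) = {R0, R1, R2} := by
        ext R
        simp only [Finset.mem_insert, Finset.mem_singleton]
        tauto
      rw [if_neg h02, if_pos rfl, hs, Finset.sum_insert (by simp [h02, d4]),
        Finset.sum_pair d2.symm, e2, e1]
      linear_combination (-u R0 - u R1 - u R2) * h0
    · rw [if_neg h02, if_neg h13, Finset.sum_insert (by simp [h02, d4, d1.symm]),
        Finset.sum_insert (by simp [h13, d2.symm]), Finset.sum_pair d3.symm, e3, e2, e1]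
      linear_combination (-u R0 - u R1 - u R2 - u R3) * h0

/-- Multiplication by the colouring signs identifies the rational kernel with the corner kernel of
constant weight 1. -/
theorem finrank_ker_definiteSingle :
    Module.finrank ℤ (LinearMap.ker D.definiteSingle.mulVecLin) = Nat.card D.LinkComp + 1 := by
  classical
  rw [finrank_int_ker_eq, ← D.finrank_cornerKer (k := ℚ) fun _ => 1]
  obtain ⟨ε', h1', h2'⟩ := D.exists_checkerboard
  let ε : D.Region → ℚ := fun R => ε' R
  have h1 : ∀ R, ε R * ε R = 1 := fun R => by
    simp only [ε]
    exact_mod_cast h1' R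
  have h2 : ∀ a ∈ D.darts, ε (D.region (D.rev a)) = -ε (D.region a) := fun a ha => by
    simp only [ε]
    exact_mod_cast h2' a ha
  have hA : ∀ u x, (D.definiteSingle.map (Int.cast : ℤ → ℚ)).mulVec u x =
      ∑ R, (if D.OnBoundary x R then u R else 0) := by
    intro u x
    simp only [Matrix.mulVec, dotProduct, definiteSingle, Matrix.map_apply, Matrix.of_apply]
    refine Finset.sum_congr rfl fun R _ => ?_
    split_ifs <;> simp
  have hker : ∀ u, u ∈ LinearMap.ker (D.definiteSingle.map (Int.cast : ℤ → ℚ)).mulVecLin ↔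
      (fun R => ε R * u R) ∈ D.cornerKer ℚ fun _ => 1 := by
    intro u
    rw [LinearMap.mem_ker, mem_cornerKer]
    constructor
    · intro hu a ha h
      let x : D.Crossing := ⟨D.vertex a, h⟩
      have h3 := congrFun hu x
      rw [Matrix.mulVecLin_apply, hA, D.sum_onBoundary (x := x) ha rfl h1 h2] at h3
      rcases mul_eq_zero.1 h3 with h4 | h4
      · have := h1 (D.region a)
        rw [h4] at this
        norm_num at this
      · exact h4
    · intro hu
      ext x
      obtain ⟨a, ha, hx⟩ := D.exists_dart_at x
      rw [Matrix.mulVecLin_apply, hA, D.sum_onBoundary ha hx h1 h2, hu a ha (hx ▸ x.2)]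
      simp
  have hεε : ∀ u : D.Region → ℚ, (fun R => ε R * (ε R * u R)) = u := fun u => by
    ext R
    rw [← mul_assoc, h1, one_mul]
  refine LinearEquiv.finrank_eq
    { toFun := fun u => ⟨fun R => ε R * u.1 R, (hker u.1).1 u.2⟩
      map_add' := by
        intro x y
        ext R
        simp [mul_add]
      map_smul' := by
        intro c x
        ext R
        simp; ring
      invFun := fun u => ⟨fun R => ε R * u.1 R, (hker _).2 (by rw [hεε]; exact u.2)⟩
      left_inv := fun u => Subtype.ext (hεε u.1)
      right_inv := fun u => Subtype.ext (hεε u.1) }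

-- A region can touch the crossing only at this corner and the opposite one, and both start with the
-- same kind of strand, so the order of the cases in the definition is immaterial.
open Classical in
theorem alternatingSingle_region {x : D.Crossing} {b : E} (hb : b ∈ D.darts)
    (hx : D.vertex b = x.1) :
    D.alternatingSingle x (D.region b) = if b ∈ D.overpass then -1 else 1 := by
  have h : D.degree D.darts (D.vertex b) = 4 := hx ▸ x.2
  have n1 := D.vertex_next hb
  have o1 := D.overpass_turn b hb h
  have o2 := D.overpass_turn _ (D.next_mem hb) (by rw [n1]; exact h)
  have d1 := D.region_next_ne hb
  have d4 := D.region_next_ne (D.next_mem (D.next_mem (D.next_mem hb)))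
  rw [D.next_four hb h] at d4
  change D.next b ∈ _ ↔ _ at o1
  change D.next (D.next b) ∈ _ ↔ _ at o2
  have key : ∀ b' ∈ D.darts, D.vertex b' = x.1 → D.region b' = D.region b →
      (b' ∈ D.overpass ↔ b ∈ D.overpass) := by
    intro b' hb' hv hR
    rcases D.eq_next_of_vertex_eq hb h hb' (hv.trans hx.symm) with rfl | rfl | rfl | rfl
    · rfl
    · exact absurd hR d1
    · tauto
    · exact absurd hR.symm d4
  have hn : D.TouchesPos x (D.region b) ↔ b ∉ D.overpass :=
    ⟨fun ⟨b', hb', hv, ho, hR⟩ => mt (key b' hb' hv hR).2 ho, fun ho => ⟨b, hb, hx, ho, rfl⟩⟩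
  have hp : D.TouchesNeg x (D.region b) ↔ b ∈ D.overpass :=
    ⟨fun ⟨b', hb', hv, ho, hR⟩ => (key b' hb' hv hR).1 ho, fun ho => ⟨b, hb, hx, ho, rfl⟩⟩
  simp only [alternatingSingle, Matrix.of_apply, hn, hp]
  split_ifs <;> simp_all

/-- The two matrices differ by signs of the rows and of the columns. -/
theorem alternatingSingle_eq {ε : D.Region → ℤ} (h1 : ∀ R, ε R * ε R = 1)
    (h2 : ∀ a ∈ D.darts, ε (D.region (D.rev a)) = -ε (D.region a)) (x : D.Crossing) :
    ∃ σ : ℤ, σ ≠ 0 ∧ ∀ R, D.alternatingSingle x R = σ * (D.definiteSingle x R * ε R) := by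
  classical
  obtain ⟨a, ha, hx⟩ := D.exists_dart_at x
  have h : D.degree D.darts (D.vertex a) = 4 := hx ▸ x.2
  have hnext : ∀ b ∈ D.darts, ε (D.region (D.next b)) = -ε (D.region b) := fun b hb => by
    rw [← D.region_rev_next hb, h2 _ (D.next_mem hb), neg_neg]
  -- The matrix entry and the colouring both change sign from one corner to the next, so their
  -- product is constant around the crossing and serves as the row sign.
  let σ : E → ℤ := fun b => D.alternatingSingle x (D.region b) * ε (D.region b)
  have hσ : ∀ b ∈ D.darts, D.vertex b = x.1 → σ (D.next b) = σ b := by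
    intro b hb hv
    have o1 : D.next b ∈ D.overpass ↔ b ∉ D.overpass := D.overpass_turn b hb (hv ▸ x.2)
    simp only [σ]
    rw [D.alternatingSingle_region hb hv,
      D.alternatingSingle_region (D.next_mem hb) ((D.vertex_next hb).trans hv), hnext b hb]
    by_cases hbo : b ∈ D.overpass
    · rw [if_pos hbo, if_neg (fun h' => o1.1 h' hbo)]; ring
    · rw [if_neg hbo, if_pos (o1.2 hbo)]; ring
  have n1 := (D.vertex_next ha).trans hx
  have n2 := (D.vertex_next (D.next_mem ha)).trans n1
  have m1 := D.next_mem ha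
  have m2 := D.next_mem m1
  have hval : ∀ b, D.alternatingSingle x (D.region b) = σ b * ε (D.region b) := fun b => by
    simp only [σ]
    rw [mul_assoc, h1, mul_one]
  refine ⟨σ a, ?_, fun R => ?_⟩
  · simp only [σ]
    rw [D.alternatingSingle_region ha hx]
    refine mul_ne_zero (by split_ifs <;> decide) fun h0 => ?_
    have := h1 (D.region a)
    rw [h0] at this
    omega
  · by_cases hR : D.OnBoundary x R
    · simp only [definiteSingle, Matrix.of_apply, if_pos hR, one_mul]
      rcases (D.onBoundary_iff ha hx R).1 hR with rfl | rfl | rfl | rfl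
      · exact hval a
      · rw [hval, hσ a ha hx]
      · rw [hval, hσ _ m1 n1, hσ a ha hx]
      · rw [hval, hσ _ m2 n2, hσ _ m1 n1, hσ a ha hx]
    · have hp : ¬ D.TouchesPos x R := fun ⟨b, _, hv, _, hb⟩ => hR ⟨b, hv, hb⟩
      have hn : ¬ D.TouchesNeg x R := fun ⟨b, _, hv, _, hb⟩ => hR ⟨b, hv, hb⟩
      simp [alternatingSingle, definiteSingle, hp, hn, hR]

theorem finrank_ker_alternatingSingle :
    Module.finrank ℤ (LinearMap.ker D.alternatingSingle.mulVecLin) = Nat.card D.LinkComp + 1 := by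
  rw [← D.finrank_ker_definiteSingle]
  obtain ⟨ε, h1, h2⟩ := D.exists_checkerboard
  choose σ hσ0 hσ using D.alternatingSingle_eq h1 h2
  have hker : ∀ u, u ∈ LinearMap.ker D.alternatingSingle.mulVecLin ↔
      (fun R => ε R * u R) ∈ LinearMap.ker D.definiteSingle.mulVecLin := by
    intro u
    have key : ∀ x, D.alternatingSingle.mulVec u x =
        σ x * D.definiteSingle.mulVec (fun R => ε R * u R) x := by
      intro x
      simp only [Matrix.mulVec, dotProduct, Finset.mul_sum]
      refine Finset.sum_congr rfl fun R _ => ?_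
      rw [hσ]; ring
    rw [LinearMap.mem_ker, LinearMap.mem_ker, Matrix.mulVecLin_apply, Matrix.mulVecLin_apply,
      funext_iff, funext_iff]
    refine forall_congr' fun x => ?_
    rw [key]
    simp [hσ0 x]
  have hεε : ∀ u : D.Region → ℤ, (fun R => ε R * (ε R * u R)) = u := fun u => by
    ext R
    rw [← mul_assoc, h1, one_mul]
  refine LinearEquiv.finrank_eq
    { toFun := fun u => ⟨fun R => ε R * u.1 R, (hker u.1).1 u.2⟩
      map_add' := by
        intro x y
        ext R
        simp [mul_add]
      map_smul' := by
        intro c x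
        ext R
        simp; ring
      invFun := fun u => ⟨fun R => ε R * u.1 R, (hker _).2 (by rw [hεε]; exact u.2)⟩
      left_inv := fun u => Subtype.ext (hεε u.1)
      right_inv := fun u => Subtype.ext (hεε u.1) }

end LinkDiagram

/-! ### Ranks from the kernels by rank-nullity over the integers -/

theorem mainTheorem2 {E : Type*} [Finite E] (D : LinkDiagram E) (n d l : ℕ) (hn : 1 ≤ n)
    (hcrossings : Nat.card D.Crossing = n) (hconn : Nat.card D.ConnComp = d)
    (hlink : Nat.card D.LinkComp = l) :
    Nat.card D.Region = n + d + 1 ∧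
    (D.definiteSingle.rank : ℤ) = n + d - l ∧
    (D.alternatingSingle.rank : ℤ) = n + d - l ∧
    Module.finrank ℤ (LinearMap.ker D.definiteSingle.mulVecLin) = l + 1 ∧
    Module.finrank ℤ (LinearMap.ker D.alternatingSingle.mulVecLin) = l + 1 := by
  subst hcrossings hconn hlink
  have h0 := D.card_region
  have hrank : ∀ A : Matrix D.Crossing D.Region ℤ,
      Module.finrank ℤ (LinearMap.ker A.mulVecLin) = Nat.card D.LinkComp + 1 →
      (A.rank : ℤ) = Nat.card D.Crossing + Nat.card D.ConnComp - Nat.card D.LinkComp := by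
    intro A hA
    have h := Submodule.finrank_quotient_add_finrank (LinearMap.ker A.mulVecLin)
    rw [A.mulVecLin.quotKerEquivRange.finrank_eq, hA, Module.finrank_fintype_fun_eq_card,
      ← Nat.card_eq_fintype_card, h0] at h
    change A.rank + _ = _ at h
    omega
  exact ⟨h0, hrank _ D.finrank_ker_definiteSingle, hrank _ D.finrank_ker_alternatingSingle,
    D.finrank_ker_definiteSingle, D.finrank_ker_alternatingSingle⟩
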